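/- Write sequences $\alpha=\alpha_0\alpha_1\alpha_2\cdots\in\{-1,1\}^{\mathbb N}$, let $\varepsilon_n(\alpha)=\alpha_n$ be the $n$-th bit, and let $\overline{\alpha}(n)=\alpha_0\cdots\alpha_{n-1}$. Let $K$ denote prefix-free Kolmogorov complexity (with respect to any optimal prefix-free machine), and call $\alpha$ Kolmogorov–Chaitin complex (a KC string) if there is $k$ such that $K(\overline{\alpha}(n))\ge n-k$ for all $n$. A sequence $(x_n)$ of real numbers is called computable if there is an algorithm which, given $n$ and $m$, outputs a rational number within $2^{-m}$ of $x_n$. Let $(x_n)_{n\ge 0}$ and $(\varphi_n)_{n\ge 0}$ be computable sequences of real numbers with $\sum_{n=0}^\infty x_n^2=\infty$. Then for every KC string $\alpha$, the series $$\sum_{n=0}^{\infty}\varepsilon_n(\alpha)\,x_n\cos(2\pi n t+\varphi_n)$$ diverges (that is, its partial sums do not converge to a real number) for Lebesgue-almost every $t\in[0,1]$. -/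

import Mathlib

open Filter Topology MeasureTheory

/-! ### Prefix-free (Kolmogorov-Chaitin) complexity

Binary strings are lists of Booleans and infinite binary sequences are maps `ℕ → Bool`;
the Boolean `true` stands for the bit `1` and `false` for the bit `-1`. -/

/-- A self-delimiting machine: a partial computable function from binary programs to binary
strings such that no halting program is a proper prefix of another halting program. -/
structure IsPrefixMachine (M : List Bool →. List Bool) : Prop where
  partrec : Partrec M
  prefixFree : ∀ p q : List Bool, (M p).Dom → (M q).Dom → p <+: q → p = q

/-- `U` is an optimal (universal) prefix machine: it simulates every prefix machine with at most a
constant increase in program length. -/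
structure IsOptimalPrefixMachine (U : List Bool →. List Bool) : Prop extends
    IsPrefixMachine U where
  optimal : ∀ M : List Bool →. List Bool, IsPrefixMachine M →
    ∃ c : ℕ, ∀ p σ : List Bool, σ ∈ M p → ∃ q : List Bool, σ ∈ U q ∧ q.length ≤ p.length + c

/-- The prefix-free Kolmogorov complexity of the string `σ` with respect to the machine `U`: the
length of a shortest program for `σ` (and `⊤` if there is no program for `σ`). -/
noncomputable def prefixComplexity (U : List Bool →. List Bool) (σ : List Bool) : ℕ∞ :=
  ⨅ (p : List Bool) (_ : σ ∈ U p), (p.length : ℕ∞)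

/-- The initial segment `α 0, …, α (n - 1)` of length `n`. -/
def initialSegment (α : ℕ → Bool) (n : ℕ) : List Bool :=
  (List.range n).map α

/-- `α` is a Kolmogorov-Chaitin complex string with respect to the machine `U`:
there is a `k` such that `K(α↾n) ≥ n - k` for all `n`. -/
def IsKC (U : List Bool →. List Bool) (α : ℕ → Bool) : Prop :=
  ∃ k : ℕ, ∀ n : ℕ, (n : ℕ∞) ≤ prefixComplexity U (initialSegment α n) + k

/-! ### An optimal prefix machine exists -/

/-- Some string other than `q`, but comparable with `q`, is accepted by the code `c` within `s`
steps. -/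
def PrefixConflict (c : Nat.Partrec.Code) (q : List Bool) (s : ℕ) : Prop :=
  ∃ n < s, ((Encodable.decode (α := List Bool) n).getD []) ≠ q ∧
    (((Encodable.decode (α := List Bool) n).getD []).take q.length =
      q.take ((Encodable.decode (α := List Bool) n).getD []).length) ∧
    ((c.evaln s (Encodable.encode ((Encodable.decode (α := List Bool) n).getD []))).isSome = true)

instance (c : Nat.Partrec.Code) (q : List Bool) (s : ℕ) : Decidable (PrefixConflict c q s) := by
  unfold PrefixConflict; infer_instance

/-- Stage `s` of the standard optimal prefix machine on the program `1 ⋯ 1 (-1) q` with `e` leading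
ones: run the `e`-th code on `q`, unless a conflicting program has been accepted. -/
def universalStage (p : List Bool) (s : ℕ) : Option (List Bool) :=
  if p.idxOf false < p.length ∧ ¬ PrefixConflict (Nat.Partrec.Code.ofNatCode (p.idxOf false))
      (p.drop (p.idxOf false + 1)) s then
    ((Nat.Partrec.Code.ofNatCode (p.idxOf false)).evaln s
      (Encodable.encode (p.drop (p.idxOf false + 1)))).bind Encodable.decode
  else none

/-- The standard optimal prefix machine: the first output among the stages. -/
def universalPrefixMachine : List Bool →. List Bool :=
  fun p => Nat.rfindOpt (universalStage p)

theorem primrecPred_prefixConflict :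
    PrimrecPred fun a : Nat.Partrec.Code × List Bool × ℕ => PrefixConflict a.1 a.2.1 a.2.2 := by
  have hr : Primrec fun a : ℕ × Nat.Partrec.Code × List Bool × ℕ =>
      (Encodable.decode (α := List Bool) a.1).getD [] :=
    Primrec.option_getD.comp (Primrec.decode.comp Primrec.fst) (Primrec.const [])
  have hc : Primrec fun a : ℕ × Nat.Partrec.Code × List Bool × ℕ => a.2.1 :=
    Primrec.fst.comp Primrec.snd
  have hq : Primrec fun a : ℕ × Nat.Partrec.Code × List Bool × ℕ => a.2.2.1 :=
    Primrec.fst.comp (Primrec.snd.comp Primrec.snd)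
  have hs : Primrec fun a : ℕ × Nat.Partrec.Code × List Bool × ℕ => a.2.2.2 :=
    Primrec.snd.comp (Primrec.snd.comp Primrec.snd)
  have h1 : PrimrecPred fun a : ℕ × Nat.Partrec.Code × List Bool × ℕ =>
      (Encodable.decode (α := List Bool) a.1).getD [] = a.2.2.1 := Primrec.eq.comp hr hq
  have h2 : PrimrecPred fun a : ℕ × Nat.Partrec.Code × List Bool × ℕ =>
      ((Encodable.decode (α := List Bool) a.1).getD []).take a.2.2.1.length =
      a.2.2.1.take ((Encodable.decode (α := List Bool) a.1).getD []).length :=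
    Primrec.eq.comp (Primrec.list_take.comp (Primrec.list_length.comp hq) hr)
      (Primrec.list_take.comp (Primrec.list_length.comp hr) hq)
  have h3 : PrimrecPred fun a : ℕ × Nat.Partrec.Code × List Bool × ℕ =>
      (a.2.1.evaln a.2.2.2
        (Encodable.encode ((Encodable.decode (α := List Bool) a.1).getD []))).isSome = true :=
    Primrec.eq.comp (Primrec.option_isSome.comp (Nat.Partrec.Code.primrec_evaln.comp
      (Primrec.pair (Primrec.pair hs hc) (Primrec.encode.comp hr)))) (Primrec.const true)
  have h : PrimrecRel fun (n : ℕ) (a : Nat.Partrec.Code × List Bool × ℕ) =>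
      ((Encodable.decode (α := List Bool) n).getD []) ≠ a.2.1 ∧
      (((Encodable.decode (α := List Bool) n).getD []).take a.2.1.length =
        a.2.1.take ((Encodable.decode (α := List Bool) n).getD []).length) ∧
      ((a.1.evaln a.2.2
        (Encodable.encode ((Encodable.decode (α := List Bool) n).getD []))).isSome = true) :=
    h1.not.and (h2.and h3)
  have hs' : Primrec fun a : Nat.Partrec.Code × List Bool × ℕ => a.2.2 :=
    Primrec.snd.comp Primrec.snd
  exact (h.exists_mem_list.comp (Primrec.list_range.comp hs') Primrec.id).of_eq
    fun a => by simp [PrefixConflict]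

theorem primrec_universalStage : Primrec₂ universalStage := by
  have he : Primrec fun a : List Bool × ℕ => a.1.idxOf false :=
    Primrec.list_idxOf.comp (Primrec.const false) Primrec.fst
  have hc : Primrec fun a : List Bool × ℕ => Nat.Partrec.Code.ofNatCode (a.1.idxOf false) :=
    (Primrec.ofNat Nat.Partrec.Code).comp he
  have hq : Primrec fun a : List Bool × ℕ => a.1.drop (a.1.idxOf false + 1) :=
    Primrec.list_drop.comp (Primrec.succ.comp he) Primrec.fst
  have hcond : PrimrecPred fun a : List Bool × ℕ => a.1.idxOf false < a.1.length ∧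
      ¬ PrefixConflict (Nat.Partrec.Code.ofNatCode (a.1.idxOf false))
        (a.1.drop (a.1.idxOf false + 1)) a.2 :=
    (Primrec.nat_lt.comp he (Primrec.list_length.comp Primrec.fst)).and
      (primrecPred_prefixConflict.comp (Primrec.pair hc (Primrec.pair hq Primrec.snd))).not
  refine Primrec.ite hcond ?_ (Primrec.const none)
  exact Primrec.option_bind (Nat.Partrec.Code.primrec_evaln.comp
    (Primrec.pair (Primrec.pair Primrec.snd hc) (Primrec.encode.comp hq)))
    (Primrec.decode.comp Primrec.snd)

/-- If `q` halts by stage `t` and is a prefix of `r` or conversely, then `r` is in conflict. -/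
theorem prefixConflict_of_evaln {c : Nat.Partrec.Code} {q r : List Bool} {s t x : ℕ} (hst : s ≤ t)
    (hx : x ∈ c.evaln s (Encodable.encode q)) (hne : q ≠ r) (h : q <+: r ∨ r <+: q) :
    PrefixConflict c r t := by
  have hx' := Nat.Partrec.Code.evaln_mono hst hx
  refine ⟨Encodable.encode q, Nat.Partrec.Code.evaln_bound hx', ?_⟩
  simp only [Encodable.encodek, Option.getD_some]
  refine ⟨hne, ?_, ?_⟩
  · rcases h with h | h
    · rw [List.take_of_length_le h.length_le]
      exact List.prefix_iff_eq_take.1 h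
    · rw [List.take_of_length_le h.length_le]
      exact (List.prefix_iff_eq_take.1 h).symm
  · rw [Option.mem_def.1 hx']; rfl

theorem isPrefixMachine_universalPrefixMachine : IsPrefixMachine universalPrefixMachine := by
  refine ⟨Partrec.rfindOpt primrec_universalStage.to_comp, fun p q hp hq hpq => ?_⟩
  obtain ⟨s, y, hs⟩ := Nat.rfindOpt_dom.1 hp
  obtain ⟨t, z, ht⟩ := Nat.rfindOpt_dom.1 hq
  obtain ⟨r, rfl⟩ := hpq
  unfold universalStage at hs ht
  split_ifs at hs with hs1
  · split_ifs at ht with ht1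
    · have hmem : false ∈ p := List.idxOf_lt_length_iff.1 hs1.1
      have hidx : (p ++ r).idxOf false = p.idxOf false := List.idxOf_append_of_mem hmem
      rw [hidx, List.drop_append_of_le_length (Nat.succ_le_of_lt hs1.1)] at ht ht1
      by_contra hne
      have hr : r ≠ [] := by rintro rfl; simp at hne
      obtain ⟨x, hx, -⟩ := Option.bind_eq_some_iff.1 hs
      obtain ⟨w, hw, -⟩ := Option.bind_eq_some_iff.1 ht
      have hpre : p.drop (p.idxOf false + 1) <+: p.drop (p.idxOf false + 1) ++ r :=
        List.prefix_append _ _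
      rcases le_total s t with hst | hst
      · exact ht1.2 (prefixConflict_of_evaln hst hx (by simpa using hr) (Or.inl hpre))
      · exact hs1.2 (prefixConflict_of_evaln hst hw (by simpa using hr) (Or.inr hpre))
    · simp at ht
  · simp at hs

theorem isOptimalPrefixMachine_universalPrefixMachine :
    IsOptimalPrefixMachine universalPrefixMachine := by
  refine ⟨isPrefixMachine_universalPrefixMachine, fun M hM => ?_⟩
  obtain ⟨c, hc⟩ := Nat.Partrec.Code.exists_code.1 hM.partrec
  have hev : ∀ (q : List Bool) (x : ℕ), x ∈ c.eval (Encodable.encode q) ↔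
      ∃ σ ∈ M q, Encodable.encode σ = x := by
    intro q x
    rw [hc]
    simp
  refine ⟨Encodable.encode c + 1, fun q σ hσ => ?_⟩
  set e := Encodable.encode c with he
  set p : List Bool := List.replicate e true ++ false :: q with hp
  have hidx : p.idxOf false = e := by
    rw [hp, List.idxOf_append_of_notMem (by simp)]; simp
  have hdrop : p.drop (e + 1) = q := by
    rw [hp, List.drop_append]; simp
  have hlen : p.length = q.length + (e + 1) := by simp [hp]; omega
  have hcode : Nat.Partrec.Code.ofNatCode e = c := Denumerable.ofNat_encode c
  have hnc : ∀ s, ¬ PrefixConflict c q s := by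
    rintro s ⟨n, -, h1, h2, h3⟩
    set r := (Encodable.decode (α := List Bool) n).getD []
    obtain ⟨x, hx⟩ := Option.isSome_iff_exists.1 h3
    obtain ⟨τ, hτ, -⟩ := (hev r x).1 (Nat.Partrec.Code.evaln_sound hx)
    have hr : (M r).Dom := Part.dom_iff_mem.2 ⟨τ, hτ⟩
    have hq : (M q).Dom := Part.dom_iff_mem.2 ⟨σ, hσ⟩
    rcases le_total r.length q.length with h | h
    · rw [List.take_of_length_le h] at h2
      exact h1 (hM.prefixFree r q hr hq (List.prefix_iff_eq_take.2 h2))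
    · rw [List.take_of_length_le h] at h2
      exact h1 (hM.prefixFree q r hq hr (List.prefix_iff_eq_take.2 h2.symm)).symm
  have hstage : ∀ s, universalStage p s =
      (c.evaln s (Encodable.encode q)).bind Encodable.decode := by
    intro s
    unfold universalStage
    rw [hidx, hdrop, hcode, if_pos ⟨by omega, hnc s⟩]
  obtain ⟨s, hs⟩ := Nat.Partrec.Code.evaln_complete.1 ((hev q _).2 ⟨σ, hσ, rfl⟩)
  have hdom : (universalPrefixMachine p).Dom := Nat.rfindOpt_dom.2 ⟨s, σ, by
    rw [hstage, Option.mem_def.1 hs]; simp⟩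
  obtain ⟨τ, hτ⟩ := Part.dom_iff_mem.1 hdom
  obtain ⟨t, ht⟩ := Nat.rfindOpt_spec hτ
  rw [hstage] at ht
  obtain ⟨x, hx, hxτ⟩ := Option.bind_eq_some_iff.1 ht
  obtain ⟨σ', hσ', rfl⟩ := (hev q x).1 (Nat.Partrec.Code.evaln_sound hx)
  rw [Encodable.encodek, Option.some_inj] at hxτ
  rw [Part.mem_unique hσ hσ', hxτ]
  exact ⟨p, hτ, hlen.le⟩

/-! ### Computable sequences of reals and the random trigonometric series -/

/-- A computable sequence of real numbers: given `n` and `k` one can compute natural numbers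
`a`, `b`, `d` such that the rational number `(a - b) / (d + 1)` approximates `x n` to within
`2 ^ (-k)`. -/
def IsComputableRealSeq (x : ℕ → ℝ) : Prop :=
  ∃ a b d : ℕ → ℕ → ℕ, Computable₂ a ∧ Computable₂ b ∧ Computable₂ d ∧
    ∀ n k : ℕ, |x n - ((a n k : ℝ) - (b n k : ℝ)) / ((d n k : ℝ) + 1)| ≤ (1 / 2 : ℝ) ^ k

/-- The Rademacher sequence determined by `α`: `ε_n(α) = ±1` is the `n`-th bit of `α`. -/
def rademacher (α : ℕ → Bool) (n : ℕ) : ℝ :=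
  if α n then 1 else -1

/-- The sum of the first `N` terms (indices `0, …, N - 1`) of the series
`∑ ε_n(α) x_n cos (2 π n t + φ_n)`. -/
noncomputable def randomFourierPartialSum (α : ℕ → Bool) (x φ : ℕ → ℝ) (N : ℕ) (t : ℝ) : ℝ :=
  ∑ n ∈ Finset.range N, rademacher α n * x n * Real.cos (2 * Real.pi * n * t + φ n)

/-!
The series is tested on its boundedness. For fixed signs, convergence on a set of positive measure
in `t` gives a bound `M` and a set of positive measure on which all partial sums are bounded by `M`.
With `s = 2 π t`, it suffices to show that for a KC string `α` the set of `s` in `[0, R)` with all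
partial sums bounded by `M` is null (`volume_bounded_partialSums_eq_zero`).

If that set had measure above `1 / Q`, then for every `N` at least a fraction of the points of a
grid, fine enough for the first `N` partial sums to vary by at most `1` between neighbours, would
see partial sums bounded by `M + 1`. Whether the signs of a string of length `N` do this can be
decided, up to a tolerance, since the terms are computable (`exists_gridTest`). These sets of strings
contain all prefixes of `α`, and their uniform measures tend to `0` for the following reasons.

* For fixed `s`, the sign patterns with partial sums bounded by `M` form a fraction of at most
  `2 exp (-c V)`, where `V` is the variance `∑ (x j cos (j s + φ j)) ^ 2`
  (`card_bounded_signSum_le`). Indeed `cos (u S)` is positive for such patterns and small `u`, and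
  its average over one more sign is multiplied by `cos (u a)`.
* The variance diverges for almost every `s`, by the Riemann-Lebesgue lemma
  (`ae_tendsto_sum_sq_cos`), so that the integral of `exp (-c V)` tends to `0` by dominated
  convergence, and it dominates the average over the grid.

Finally, uniformly decidable sets of strings of length `N` whose measures come arbitrarily close to
`0` cannot contain all prefixes of a KC string (`not_isKC_of_decidable_null`): an element of a small
set is described by its rank in that set.
-/

/-! ### Computable functions -/

section ComputableArith

variable {β γ : Type*} [Primcodable β] [Primcodable γ]

theorem Computable.natAdd {f g : β → ℕ} (hf : Computable f) (hg : Computable g) :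
    Computable fun a => f a + g a := Primrec.nat_add.to_comp.comp hf hg

theorem Computable.natMul {f g : β → ℕ} (hf : Computable f) (hg : Computable g) :
    Computable fun a => f a * g a := Primrec.nat_mul.to_comp.comp hf hg

theorem Primrec.natPow : Primrec₂ ((· ^ ·) : ℕ → ℕ → ℕ) :=
  Primrec₂.unpaired'.1 Nat.Primrec.pow

theorem Computable.natPow {f g : β → ℕ} (hf : Computable f) (hg : Computable g) :
    Computable fun a => f a ^ g a :=
  Primrec.natPow.to_comp.comp hf hg

theorem Computable.decideNatLe {f g : β → ℕ} (hf : Computable f) (hg : Computable g) :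
    Computable fun a => decide (f a ≤ g a) := Primrec.nat_le.decide.to_comp.comp hf hg

theorem Computable.decideEq [DecidableEq γ] {f g : β → γ} (hf : Computable f)
    (hg : Computable g) : Computable fun a => decide (f a = g a) :=
  Primrec.eq.decide.to_comp.comp hf hg

theorem Computable.boolAnd {f g : β → Bool} (hf : Computable f) (hg : Computable g) :
    Computable fun a => (f a && g a) := Primrec.and.to_comp.comp hf hg

theorem Primrec.testBit : Primrec₂ Nat.testBit := by
  refine (Primrec.eq.decide.comp (Primrec.nat_mod.comp (Primrec.nat_div.comp Primrec.fst
    (Primrec.natPow.comp (Primrec.const 2) Primrec.snd)) (Primrec.const 2))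
      (Primrec.const 1)).of_eq fun a => ?_
  exact Nat.testBit_eq_decide_div_mod_eq.symm

theorem Computable.natSum {f : β → ℕ → ℕ} {g : β → ℕ} (hf : Computable₂ f)
    (hg : Computable g) : Computable fun a => ∑ i ∈ Finset.range (g a), f a i := by
  refine (Computable.nat_rec (h := fun a p => p.2 + f a p.1) hg (Computable.const 0)
    ((Computable.snd.comp Computable.snd).natAdd (hf.comp Computable.fst
      (Computable.fst.comp Computable.snd)))).of_eq fun a => ?_
  induction g a with
  | zero => simp
  | succ n ih => rw [Finset.sum_range_succ, ← ih]

theorem Computable.natCount {f : β → ℕ → Bool} {g : β → ℕ} (hf : Computable₂ f)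
    (hg : Computable g) : Computable fun a => Nat.count (fun i => f a i = true) (g a) := by
  refine (Computable.natSum (f := fun a i => bif f a i then 1 else 0)
    (Computable.cond hf (Computable.const 1) (Computable.const 0)) hg).of_eq fun a => ?_
  rw [Nat.count_eq_card_filter_range, Finset.card_filter]
  refine Finset.sum_congr rfl fun i _ => ?_
  cases f a i <;> rfl

/-- Unbounded search: a decidable relation that is total has a computable choice function. -/
theorem exists_computable_choice {p : β → ℕ → Bool} (hp : Computable₂ p)
    (h : ∀ a, ∃ n, p a n = true) : ∃ g : β → ℕ, Computable g ∧ ∀ a, p a (g a) = true := by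
  refine ⟨fun a => Nat.find (h a), ?_, fun a => Nat.find_spec (h a)⟩
  refine (Partrec.rfind (p := fun a n => (p a n : Part Bool)) hp.partrec₂).of_eq_tot fun a => ?_
  refine Nat.mem_rfind.2 ⟨?_, fun {m} hm => ?_⟩
  · simpa using (Nat.find_spec (h a)).symm
  · simpa using (Nat.find_min (h a) hm)

end ComputableArith

/-! ### Rational codes and computable real functions -/

/-- A code `(a, b, d)` for the rational number `(a - b) / (d + 1)`. -/
abbrev RatCode := ℕ × ℕ × ℕ

namespace RatCode

/-- The real number `(a - b) / (d + 1)` with code `(a, b, d)`. -/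
noncomputable def val (q : RatCode) : ℝ := ((q.1 : ℝ) - (q.2.1 : ℝ)) / ((q.2.2 : ℝ) + 1)

/-- Addition of rational codes. -/
def add (q r : RatCode) : RatCode :=
  (q.1 * (r.2.2 + 1) + r.1 * (q.2.2 + 1), q.2.1 * (r.2.2 + 1) + r.2.1 * (q.2.2 + 1),
    q.2.2 * r.2.2 + q.2.2 + r.2.2)

/-- Multiplication of rational codes. -/
def mul (q r : RatCode) : RatCode :=
  (q.1 * r.1 + q.2.1 * r.2.1, q.1 * r.2.1 + q.2.1 * r.1, q.2.2 * r.2.2 + q.2.2 + r.2.2)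

theorem val_add (q r : RatCode) : (add q r).val = q.val + r.val := by
  have h1 : (q.2.2 : ℝ) + 1 ≠ 0 := by positivity
  have h2 : (r.2.2 : ℝ) + 1 ≠ 0 := by positivity
  have h3 : ((q.2.2 * r.2.2 + q.2.2 + r.2.2 : ℕ) : ℝ) + 1 = (q.2.2 + 1) * (r.2.2 + 1) := by
    push_cast; ring
  simp only [val, add]
  rw [h3, div_add_div _ _ h1 h2]
  push_cast
  ring

theorem val_mul (q r : RatCode) : (mul q r).val = q.val * r.val := by
  have h3 : ((q.2.2 * r.2.2 + q.2.2 + r.2.2 : ℕ) : ℝ) + 1 = (q.2.2 + 1) * (r.2.2 + 1) := by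
    push_cast; ring
  simp only [val, mul]
  rw [h3, div_mul_div_comm]
  push_cast
  ring

theorem abs_val_le (q : RatCode) : |q.val| ≤ ((q.1 + q.2.1 : ℕ) : ℝ) := by
  have h : (0 : ℝ) < (q.2.2 : ℝ) + 1 := by positivity
  rw [val, abs_div, abs_of_pos h, div_le_iff₀ h]
  have h1 : |(q.1 : ℝ) - q.2.1| ≤ q.1 + q.2.1 := by
    rw [abs_le]; constructor <;> linarith [Nat.cast_nonneg (α := ℝ) q.1,
      Nat.cast_nonneg (α := ℝ) q.2.1]
  push_cast
  nlinarith [Nat.cast_nonneg (α := ℝ) q.1, Nat.cast_nonneg (α := ℝ) q.2.1,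
    Nat.cast_nonneg (α := ℝ) q.2.2]

variable {β : Type*} [Primcodable β]

theorem computable_add {f g : β → RatCode} (hf : Computable f) (hg : Computable g) :
    Computable fun a => add (f a) (g a) := by
  have f1 := Computable.fst.comp hf
  have f2 := Computable.fst.comp (Computable.snd.comp hf)
  have f3 := Computable.snd.comp (Computable.snd.comp hf)
  have g1 := Computable.fst.comp hg
  have g2 := Computable.fst.comp (Computable.snd.comp hg)
  have g3 := Computable.snd.comp (Computable.snd.comp hg)
  have one : Computable fun _ : β => 1 := Computable.const 1
  exact ((f1.natMul (g3.natAdd one)).natAdd (g1.natMul (f3.natAdd one))).pair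
    (((f2.natMul (g3.natAdd one)).natAdd (g2.natMul (f3.natAdd one))).pair
      (((f3.natMul g3).natAdd f3).natAdd g3))

theorem computable_mul {f g : β → RatCode} (hf : Computable f) (hg : Computable g) :
    Computable fun a => mul (f a) (g a) := by
  have f1 := Computable.fst.comp hf
  have f2 := Computable.fst.comp (Computable.snd.comp hf)
  have f3 := Computable.snd.comp (Computable.snd.comp hf)
  have g1 := Computable.fst.comp hg
  have g2 := Computable.fst.comp (Computable.snd.comp hg)
  have g3 := Computable.snd.comp (Computable.snd.comp hg)
  exact ((f1.natMul g1).natAdd (f2.natMul g2)).pair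
    (((f1.natMul g2).natAdd (f2.natMul g1)).pair (((f3.natMul g3).natAdd f3).natAdd g3))

theorem exists_computable_sum {f : β → ℕ → RatCode} {g : β → ℕ} (hf : Computable₂ f)
    (hg : Computable g) : ∃ s : β → RatCode, Computable s ∧
      ∀ a, (s a).val = ∑ i ∈ Finset.range (g a), (f a i).val := by
  refine ⟨_, Computable.nat_rec (h := fun a p => add p.2 (f a p.1)) hg
    (Computable.const (0, 0, 0)) (computable_add (Computable.snd.comp Computable.snd)
      (hf.comp Computable.fst (Computable.fst.comp Computable.snd))), fun a => ?_⟩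
  induction g a with
  | zero => simp [val]
  | succ n ih => rw [Finset.sum_range_succ, ← ih, ← val_add]

/-- The code of the `i`-th term `(-1) ^ i r ^ (2 i) / (2 i)!` of the cosine series at `r`. -/
def cosTerm (r : RatCode) (i : ℕ) : RatCode :=
  Nat.rec (1, 0, 0) (fun j t => mul t (mul (mul r r) (0, 1, 4 * (j * j) + 6 * j + 1))) i

theorem val_cosTerm (r : RatCode) (i : ℕ) :
    (cosTerm r i).val = (-1) ^ i * r.val ^ (2 * i) / ((2 * i).factorial : ℝ) := by
  induction i with
  | zero => simp [cosTerm, val]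
  | succ n ih =>
    have : cosTerm r (n + 1) =
      mul (cosTerm r n) (mul (mul r r) (0, 1, 4 * (n * n) + 6 * n + 1)) := rfl
    rw [this, val_mul, ih, val_mul, val_mul, show 2 * (n + 1) = 2 * n + 1 + 1 by ring,
      Nat.factorial_succ, Nat.factorial_succ]
    have h : ((2 * n).factorial : ℝ) ≠ 0 := by positivity
    have h2 : (2 * (n : ℝ) + 1) ≠ 0 := by positivity
    have h3 : (2 * (n : ℝ) + 1 + 1) ≠ 0 := by positivity
    have h4 : val (0, 1, 4 * (n * n) + 6 * n + 1) =
        -1 / ((2 * (n : ℝ) + 1) * (2 * (n : ℝ) + 1 + 1)) := by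
      simp only [val]; push_cast; congr 1 <;> ring
    rw [h4]
    push_cast
    field_simp
    ring

theorem computable_cosTerm {f : β → RatCode} {g : β → ℕ} (hf : Computable f)
    (hg : Computable g) : Computable fun a => cosTerm (f a) (g a) := by
  have hj : Computable fun p : β × ℕ × RatCode => p.2.1 :=
    Computable.fst.comp Computable.snd
  have hr : Computable fun p : β × ℕ × RatCode => f p.1 := hf.comp Computable.fst
  exact Computable.nat_rec
    (h := fun a p => mul p.2 (mul (mul (f a) (f a)) (0, 1, 4 * (p.1 * p.1) + 6 * p.1 + 1)))
    hg (Computable.const (1, 0, 0))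
    (computable_mul (Computable.snd.comp Computable.snd) (computable_mul (computable_mul hr hr)
      ((Computable.const 0).pair ((Computable.const 1).pair
        ((((Computable.const 4).natMul (hj.natMul hj)).natAdd
          ((Computable.const 6).natMul hj)).natAdd (Computable.const 1))))))

end RatCode

/-- The cosine series converges fast: `2 B ^ 2 + k + 2` terms suffice for precision `2 ^ (-k)` on
`[-B, B]`. -/
theorem abs_cos_sub_sum_le (y : ℝ) (B k : ℕ) (hy : |y| ≤ B) :
    |Real.cos y - ∑ i ∈ Finset.range (2 * B ^ 2 + k + 2),
      (-1) ^ i * y ^ (2 * i) / ((2 * i).factorial : ℝ)| ≤ (1 / 2 : ℝ) ^ k := by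
  set j := 2 * B ^ 2 + k + 2 with hj
  have hnorm : ‖(y : ℂ) * Complex.I‖ = |y| := by simp
  have hBj : 2 * B ≤ 2 * j + 1 := by nlinarith
  have hBj' : (2 * B : ℝ) ≤ 2 * j + 1 := by exact_mod_cast hBj
  have h1 := Complex.exp_bound' (x := (y : ℂ) * Complex.I) (n := 2 * j) (by
    rw [hnorm, div_le_iff₀ (by positivity)]
    push_cast
    linarith)
  have hre : (Complex.exp ((y : ℂ) * Complex.I) -
      ∑ m ∈ Finset.range (2 * j), ((y : ℂ) * Complex.I) ^ m / (m.factorial : ℂ)).re =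
      Real.cos y - ∑ i ∈ Finset.range j, (-1) ^ i * y ^ (2 * i) / ((2 * i).factorial : ℝ) := by
    rw [Complex.sub_re, Complex.exp_ofReal_mul_I_re]
    congr 1
    clear_value j
    clear hj hBj hBj' h1
    induction j with
    | zero => simp
    | succ n ih =>
      rw [show 2 * (n + 1) = 2 * n + 1 + 1 by ring, Finset.sum_range_succ, Finset.sum_range_succ,
        Finset.sum_range_succ, Complex.add_re, Complex.add_re, ih]
      have e1 : (((y : ℂ) * Complex.I) ^ (2 * n) / ((2 * n).factorial : ℂ)) =
          (((-1) ^ n * y ^ (2 * n) / ((2 * n).factorial : ℝ) : ℝ) : ℂ) := by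
        rw [mul_pow, pow_mul Complex.I, Complex.I_sq]; push_cast; ring
      have e2 : (((y : ℂ) * Complex.I) ^ (2 * n + 1) / ((2 * n + 1).factorial : ℂ)) =
          (((-1) ^ n * y ^ (2 * n + 1) / ((2 * n + 1).factorial : ℝ) : ℝ) : ℂ) * Complex.I := by
        rw [mul_pow, pow_succ Complex.I, pow_mul Complex.I, Complex.I_sq]; push_cast; ring
      rw [e1, e2, Complex.ofReal_re, Complex.re_ofReal_mul, Complex.I_re]
      ring
  rw [← hre]
  refine (Complex.abs_re_le_norm _).trans (h1.trans ?_)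
  rw [hnorm]
  -- `j ^ j ≤ (2 j)!`, so that the tail is at most `2 (y ^ 2 / j) ^ j ≤ 2 (1 / 2) ^ j`
  have hfac : ((j : ℝ)) ^ j ≤ ((2 * j).factorial : ℝ) := by
    have h := Nat.factorial_mul_pow_le_factorial (m := j) (n := j)
    have h' : j ^ j ≤ (2 * j).factorial := by
      rw [two_mul]
      refine le_trans ?_ h
      calc j ^ j ≤ (j + 1) ^ j := Nat.pow_le_pow_left (Nat.le_succ j) j
        _ ≤ _ := Nat.le_mul_of_pos_left _ (Nat.factorial_pos j)
    exact_mod_cast h'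
  have hjpos : (0 : ℝ) < j := by
    have : 0 < j := by omega
    exact_mod_cast this
  have hB2 : y ^ 2 / j ≤ 1 / 2 := by
    rw [div_le_iff₀ hjpos]
    have h2 : y ^ 2 ≤ (B : ℝ) ^ 2 := by rw [← sq_abs]; gcongr
    have h3 : (2 * (B : ℝ) ^ 2) ≤ j := by
      have : 2 * B ^ 2 ≤ j := by omega
      exact_mod_cast this
    linarith
  calc |y| ^ (2 * j) / ((2 * j).factorial : ℝ) * 2
      ≤ |y| ^ (2 * j) / ((j : ℝ) ^ j) * 2 := by gcongr
    _ = (y ^ 2 / j) ^ j * 2 := by rw [pow_mul, sq_abs, div_pow]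
    _ ≤ (1 / 2) ^ j * 2 := by
        have : 0 ≤ y ^ 2 / j := by positivity
        gcongr
    _ ≤ (1 / 2 : ℝ) ^ (k + 1) * 2 := by
        have : (1 / 2 : ℝ) ^ j ≤ (1 / 2) ^ (k + 1) :=
          pow_le_pow_of_le_one (by norm_num) (by norm_num) (by omega)
        linarith
    _ = (1 / 2) ^ k := by rw [pow_succ]; ring

/-- A real function on a primitively encodable type is computable if its values can be computed
to within `2 ^ (-k)`, uniformly in the argument and `k`. -/
def IsComputableRealFun {β : Type*} [Primcodable β] (f : β → ℝ) : Prop :=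
  ∃ q : β → ℕ → RatCode, Computable₂ q ∧ ∀ x k, |f x - (q x k).val| ≤ (1 / 2 : ℝ) ^ k

theorem IsComputableRealSeq.isComputableRealFun {x : ℕ → ℝ} (hx : IsComputableRealSeq x) :
    IsComputableRealFun x := by
  obtain ⟨a, b, d, ha, hb, hd, h⟩ := hx
  exact ⟨fun n k => (a n k, b n k, d n k), Computable.pair ha (Computable.pair hb hd), h⟩

namespace IsComputableRealFun

variable {β γ : Type*} [Primcodable β] [Primcodable γ]

theorem comp {f : γ → ℝ} {g : β → γ} (hf : IsComputableRealFun f) (hg : Computable g) :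
    IsComputableRealFun fun x => f (g x) := by
  obtain ⟨q, hq, h⟩ := hf
  exact ⟨fun x k => q (g x) k, hq.comp (hg.comp Computable.fst) Computable.snd,
    fun x k => h (g x) k⟩

theorem of_ratCode {f : β → RatCode} (hf : Computable f) :
    IsComputableRealFun fun x => (f x).val :=
  ⟨fun x _ => f x, hf.comp Computable.fst, fun x k => by simp⟩

theorem exists_bound {f : β → ℝ} (hf : IsComputableRealFun f) :
    ∃ B : β → ℕ, Computable B ∧ ∀ x, |f x| ≤ B x := by
  obtain ⟨q, hq, h⟩ := hf
  have h0 : Computable fun x => q x 0 := hq.comp Computable.id (Computable.const 0)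
  refine ⟨fun x => (q x 0).1 + (q x 0).2.1 + 1, ((Computable.fst.comp h0).natAdd
    (Computable.fst.comp (Computable.snd.comp h0))).natAdd (Computable.const 1), fun x => ?_⟩
  have h1 := h x 0
  have h2 := (q x 0).abs_val_le
  have h3 := abs_add_le (f x - (q x 0).val) (q x 0).val
  rw [sub_add_cancel] at h3
  push_cast at h2 ⊢
  linarith [pow_zero (1 / 2 : ℝ)]

theorem add {f g : β → ℝ} (hf : IsComputableRealFun f) (hg : IsComputableRealFun g) :
    IsComputableRealFun fun x => f x + g x := by
  obtain ⟨q, hq, h⟩ := hf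
  obtain ⟨r, hr, h'⟩ := hg
  have hk : Computable fun p : β × ℕ => p.2 + 1 := Computable.snd.natAdd (Computable.const 1)
  refine ⟨fun x k => RatCode.add (q x (k + 1)) (r x (k + 1)),
    RatCode.computable_add (hq.comp Computable.fst hk) (hr.comp Computable.fst hk),
    fun x k => ?_⟩
  have h1 := abs_le.1 (h x (k + 1))
  have h2 := abs_le.1 (h' x (k + 1))
  rw [RatCode.val_add, abs_le]
  rw [pow_succ] at h1 h2
  constructor <;> linarith

theorem mul {f g : β → ℝ} (hf : IsComputableRealFun f) (hg : IsComputableRealFun g) :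
    IsComputableRealFun fun x => f x * g x := by
  obtain ⟨B, hB, hfB⟩ := hf.exists_bound
  obtain ⟨C, hC, hgC⟩ := hg.exists_bound
  obtain ⟨q, hq, h⟩ := hf
  obtain ⟨r, hr, h'⟩ := hg
  have hk : Computable fun p : β × ℕ => p.2 + (B p.1 + C p.1 + 1) :=
    Computable.snd.natAdd (((hB.comp Computable.fst).natAdd (hC.comp Computable.fst)).natAdd
      (Computable.const 1))
  refine ⟨fun x k => RatCode.mul (q x (k + (B x + C x + 1))) (r x (k + (B x + C x + 1))),
    RatCode.computable_mul (hq.comp Computable.fst hk) (hr.comp Computable.fst hk),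
    fun x k => ?_⟩
  set n := k + (B x + C x + 1) with hn
  have h1 := h x n
  have h2 := h' x n
  rw [RatCode.val_mul]
  set u := (q x n).val
  set v := (r x n).val
  set e := (1 / 2 : ℝ) ^ n with he
  have he0 : 0 ≤ e := by positivity
  have he1 : e ≤ 1 := pow_le_one₀ (by norm_num) (by norm_num)
  -- `f g - u v = f (g - v) + (f - u) g - (f - u) (g - v)`
  have key : |f x * g x - u * v| ≤ (B x + C x + 1) * e := by
    have e1 : f x * g x - u * v =
        f x * (g x - v) + ((f x - u) * g x + -((f x - u) * (g x - v))) := by ring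
    rw [e1]
    refine (abs_add_le _ _).trans ((add_le_add_right (abs_add_le _ _) _).trans ?_)
    rw [abs_neg, abs_mul, abs_mul, abs_mul]
    have m1 : |f x| * |g x - v| ≤ B x * e :=
      mul_le_mul (hfB x) h2 (abs_nonneg _) (Nat.cast_nonneg _)
    have m2 : |f x - u| * |g x| ≤ e * C x :=
      mul_le_mul h1 (hgC x) (abs_nonneg _) he0
    have m3 : |f x - u| * |g x - v| ≤ e * 1 :=
      mul_le_mul h1 (h2.trans he1) (abs_nonneg _) he0
    linarith
  refine key.trans ?_
  have hp : ((B x + C x + 1 : ℕ) : ℝ) ≤ 2 ^ (B x + C x + 1) := by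
    exact_mod_cast Nat.lt_two_pow_self.le
  push_cast at hp
  calc (B x + C x + 1 : ℝ) * e ≤ 2 ^ (B x + C x + 1) * e := by gcongr
    _ = (1 / 2) ^ k := by
      rw [he, hn, pow_add (1 / 2 : ℝ) k, mul_left_comm, ← mul_pow]; norm_num

theorem sum {f : β → ℕ → ℝ} {g : β → ℕ} (hf : IsComputableRealFun fun p : β × ℕ => f p.1 p.2)
    (hg : Computable g) : IsComputableRealFun fun x => ∑ i ∈ Finset.range (g x), f x i := by
  obtain ⟨q, hq, h⟩ := hf
  have hi : Computable fun p : (β × ℕ) × ℕ => p.1.2 + g p.1.1 :=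
    (Computable.snd.comp Computable.fst).natAdd
      (hg.comp (Computable.fst.comp Computable.fst))
  obtain ⟨s, hs, hsv⟩ := RatCode.exists_computable_sum
    (f := fun (p : β × ℕ) i => q (p.1, i) (p.2 + g p.1)) (g := fun p => g p.1)
    (hq.comp ((Computable.fst.comp Computable.fst).pair Computable.snd) hi)
    (hg.comp Computable.fst)
  refine ⟨fun x k => s (x, k), hs, fun x k => ?_⟩
  rw [hsv, ← Finset.sum_sub_distrib]
  refine (Finset.abs_sum_le_sum_abs _ _).trans
    ((Finset.sum_le_sum fun i _ => h (x, i) (k + g x)).trans ?_)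
  rw [Finset.sum_const, Finset.card_range, nsmul_eq_mul]
  have hp : (g x : ℝ) ≤ 2 ^ (g x) := by exact_mod_cast Nat.lt_two_pow_self.le
  calc (g x : ℝ) * (1 / 2) ^ (k + g x) ≤ 2 ^ (g x) * (1 / 2) ^ (k + g x) := by gcongr
    _ = (1 / 2) ^ k := by
      rw [pow_add (1 / 2 : ℝ) k, mul_left_comm, ← mul_pow]; norm_num

theorem cos {f : β → ℝ} (hf : IsComputableRealFun f) :
    IsComputableRealFun fun x => Real.cos (f x) := by
  obtain ⟨q, hq, h⟩ := hf
  have hk : Computable fun p : β × ℕ => p.2 + 1 := Computable.snd.natAdd (Computable.const 1)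
  have hq1 : Computable fun p : β × ℕ => q p.1 (p.2 + 1) := hq.comp Computable.fst hk
  have hB : Computable fun p : β × ℕ => (q p.1 (p.2 + 1)).1 + (q p.1 (p.2 + 1)).2.1 :=
    (Computable.fst.comp hq1).natAdd (Computable.fst.comp (Computable.snd.comp hq1))
  obtain ⟨s, hs, hsv⟩ := RatCode.exists_computable_sum
    (f := fun (p : β × ℕ) i => RatCode.cosTerm (q p.1 (p.2 + 1)) i)
    (g := fun p => 2 * ((q p.1 (p.2 + 1)).1 + (q p.1 (p.2 + 1)).2.1) ^ 2 + (p.2 + 1) + 2)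
    (RatCode.computable_cosTerm (hq1.comp Computable.fst) Computable.snd)
    ((((Computable.const 2).natMul (hB.natPow (Computable.const 2))).natAdd hk).natAdd
      (Computable.const 2))
  refine ⟨fun x k => s (x, k), hs, fun x k => ?_⟩
  rw [hsv]
  simp only [RatCode.val_cosTerm]
  have h1 := abs_cos_sub_sum_le _ _ (k + 1) (q x (k + 1)).abs_val_le
  have h2 : |Real.cos (f x) - Real.cos (q x (k + 1)).val| ≤ (1 / 2) ^ (k + 1) :=
    (Real.abs_cos_sub_cos_le _ _).trans (h x (k + 1))
  refine (abs_sub_le _ (Real.cos (q x (k + 1)).val) _).trans ((add_le_add h2 h1).trans ?_)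
  rw [pow_succ]; linarith

/-- Comparisons of computable reals are decidable up to a tolerance: an approximation to within
`1 / 2` is compared with `M + 1 / 2`. -/
theorem exists_decide_abs_le {f : β → ℝ} (hf : IsComputableRealFun f) (M : ℕ) :
    ∃ P : β → Bool, Computable P ∧
      ∀ x, (|f x| ≤ M → P x = true) ∧ (P x = true → |f x| ≤ M + 1) := by
  obtain ⟨q, hq, h⟩ := hf
  have h2 : Computable fun x => q x 1 := hq.comp Computable.id (Computable.const 1)
  have ha := Computable.fst.comp h2
  have hb := Computable.fst.comp (Computable.snd.comp h2)
  have hd := Computable.snd.comp (Computable.snd.comp h2)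
  have hM : Computable fun x => (2 * M + 1) * ((q x 1).2.2 + 1) :=
    (Computable.const (2 * M + 1)).natMul (hd.natAdd (Computable.const 1))
  have two : Computable fun _ : β => 2 := Computable.const 2
  refine ⟨fun x => decide (2 * (q x 1).1 ≤ 2 * (q x 1).2.1 + (2 * M + 1) * ((q x 1).2.2 + 1)) &&
    decide (2 * (q x 1).2.1 ≤ 2 * (q x 1).1 + (2 * M + 1) * ((q x 1).2.2 + 1)),
    ((two.natMul ha).decideNatLe ((two.natMul hb).natAdd hM)).boolAnd
      ((two.natMul hb).decideNatLe ((two.natMul ha).natAdd hM)), fun x => ?_⟩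
  have key : (decide (2 * (q x 1).1 ≤ 2 * (q x 1).2.1 + (2 * M + 1) * ((q x 1).2.2 + 1)) &&
      decide (2 * (q x 1).2.1 ≤ 2 * (q x 1).1 + (2 * M + 1) * ((q x 1).2.2 + 1))) = true ↔
      |(q x 1).val| ≤ M + 1 / 2 := by
    have hpos : (0 : ℝ) < ((q x 1).2.2 : ℝ) + 1 := by positivity
    rw [RatCode.val, abs_div, abs_of_pos hpos, div_le_iff₀ hpos, abs_le, Bool.and_eq_true,
      decide_eq_true_iff, decide_eq_true_iff, ← Nat.cast_le (α := ℝ), ← Nat.cast_le (α := ℝ)]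
    push_cast
    constructor
    · rintro ⟨u, v⟩; constructor <;> linarith
    · rintro ⟨u, v⟩; constructor <;> linarith
  rw [key]
  have h1 := abs_le.1 (h x 1)
  rw [pow_one] at h1
  constructor
  · intro hx
    have := abs_le.1 hx
    rw [abs_le]; constructor <;> linarith
  · intro hx
    have := abs_le.1 hx
    rw [abs_le]; constructor <;> linarith

end IsComputableRealFun

/-! ### A Kurtz test refutes complexity -/

theorem length_initialSegment (α : ℕ → Bool) (n : ℕ) : (initialSegment α n).length = n := by
  simp [initialSegment]

theorem initialSegment_congr {α β : ℕ → Bool} {n : ℕ} (h : ∀ i < n, α i = β i) :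
    initialSegment α n = initialSegment β n :=
  List.map_congr_left fun i hi => h i (List.mem_range.1 hi)

theorem initialSegment_injOn {α β : ℕ → Bool} {n : ℕ}
    (h : initialSegment α n = initialSegment β n) : ∀ i < n, α i = β i := fun i hi =>
  List.map_inj_left.1 h i (List.mem_range.2 hi)

theorem computable_initialSegment_testBit :
    Computable₂ fun m n : ℕ => initialSegment m.testBit n :=
  (Primrec.list_map (Primrec.list_range.comp Primrec.snd)
    (Primrec.testBit.comp (Primrec.fst.comp Primrec.fst) Primrec.snd).to₂).to_comp

/-- Every finite initial segment is the binary expansion of a natural number. -/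
theorem exists_testBit_eq (α : ℕ → Bool) (n : ℕ) :
    ∃ m < 2 ^ n, ∀ i < n, m.testBit i = α i := by
  refine ⟨Nat.ofBits fun i : Fin n => α i, Nat.ofBits_lt_two_pow _, fun i hi => ?_⟩
  rw [Nat.testBit_ofBits_lt _ _ hi]

/-- If the sets `A N` of strings of length `N` are uniformly decidable, and their uniform measures
`#(A N) / 2 ^ N` have infimum `0`, then no KC string has all its initial segments in these sets.
Strings of length `N` are given by the binary digits of natural numbers below `2 ^ N`.

Some computable `g` satisfies `#(A (g k)) ≤ 2 ^ (g k - 2 k)`, so that an element of `A (g k)` is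
described by `k`, in unary and self-delimiting, followed by its rank in `A (g k)`, written with
exactly `g k - 2 k` digits. -/
theorem not_isKC_of_decidable_null {U : List Bool →. List Bool} (hU : IsOptimalPrefixMachine U)
    {A : ℕ → ℕ → Bool} (hA : Computable₂ A)
    (hnull : ∀ k, ∃ N, 4 ^ k * Nat.count (fun m => A N m = true) (2 ^ N) ≤ 2 ^ N)
    {α : ℕ → Bool} (hα : ∀ N m, m < 2 ^ N → (∀ i < N, m.testBit i = α i) → A N m = true) :
    ¬ IsKC U α := by
  have hcount : Computable fun p : ℕ × ℕ => Nat.count (fun m => A p.1 m = true) p.2 :=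
    Computable.natCount (hA.comp (Computable.fst.comp Computable.fst) Computable.snd)
      Computable.snd
  have htwo : Computable fun n : ℕ => 2 ^ n := (Computable.const 2).natPow Computable.id
  obtain ⟨g, hg, hgs⟩ := exists_computable_choice
    (p := fun k N => decide (4 ^ k * Nat.count (fun m => A N m = true) (2 ^ N) ≤ 2 ^ N))
    ((((Computable.const 4).natPow Computable.fst).natMul
      (hcount.comp (Computable.snd.pair (htwo.comp Computable.snd)))).decideNatLe
        (htwo.comp Computable.snd)) (fun k => by simpa using hnull k)
  simp only [decide_eq_true_eq] at hgs
  -- a program `1 ⋯ 1 (-1) u` with `k` leading ones is split into `k` and `u`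
  let hd : List Bool → ℕ := fun p => p.idxOf false
  let tl : List Bool → List Bool := fun p => p.drop (p.idxOf false + 1)
  have hhd : Computable hd :=
    (Primrec.list_idxOf.comp (Primrec.const false) Primrec.id).to_comp
  have htl : Computable tl := (Primrec.list_drop.comp (Primrec.succ.comp
    (Primrec.list_idxOf.comp (Primrec.const false) Primrec.id)) Primrec.id).to_comp
  -- `u` has length `g k - 2 k` and consists of the digits of the rank of `m` in `A (g k)`; since
  -- `k` determines the length of `u`, no accepted program extends another one
  let test : List Bool → ℕ → Bool := fun p m =>
    decide (hd p + 1 ≤ p.length) && (decide ((tl p).length + 2 * hd p = g (hd p)) &&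
      (A (g (hd p)) m && decide (initialSegment
        (Nat.count (fun m => A (g (hd p)) m = true) m).testBit (tl p).length = tl p)))
  have htest : Computable₂ test := by
    have h1 : Computable fun q : List Bool × ℕ => hd q.1 := hhd.comp Computable.fst
    have h2 : Computable fun q : List Bool × ℕ => tl q.1 := htl.comp Computable.fst
    have h3 : Computable fun q : List Bool × ℕ => (tl q.1).length :=
      Computable.list_length.comp h2
    exact ((h1.natAdd (Computable.const 1)).decideNatLe
      (Computable.list_length.comp Computable.fst)).boolAnd
      (((h3.natAdd ((Computable.const 2).natMul h1)).decideEq (hg.comp h1)).boolAnd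
        ((hA.comp (hg.comp h1) Computable.snd).boolAnd
          ((computable_initialSegment_testBit.comp
            (hcount.comp ((hg.comp h1).pair Computable.snd)) h3).decideEq h2)))
  let M : List Bool →. List Bool := fun p =>
    (Nat.rfind fun m => Part.some (test p m)).map fun m => initialSegment m.testBit (g (hd p))
  have hMspec : ∀ {p}, (M p).Dom → hd p + 1 ≤ p.length ∧ (tl p).length + 2 * hd p = g (hd p) := by
    intro p hp
    obtain ⟨m, hm⟩ := Part.dom_iff_mem.1 (show (Nat.rfind fun m => Part.some (test p m)).Dom
      from hp)
    have := Nat.rfind_spec hm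
    have h := (Part.mem_some_iff.1 this).symm
    simp only [test, Bool.and_eq_true, decide_eq_true_eq] at h
    exact ⟨h.1, h.2.1⟩
  have hM : IsPrefixMachine M := by
    refine ⟨?_, fun p q hp hq hpq => ?_⟩
    · exact (Partrec.rfind htest.partrec₂).map (computable_initialSegment_testBit.comp
        Computable.snd (hg.comp (hhd.comp Computable.fst)))
    · obtain ⟨hp1, hp2⟩ := hMspec hp
      obtain ⟨hq1, hq2⟩ := hMspec hq
      obtain ⟨r, rfl⟩ := hpq
      have hmem : false ∈ p := List.idxOf_lt_length_iff.1 (Nat.lt_of_succ_le hp1)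
      have hidx : hd (p ++ r) = hd p := List.idxOf_append_of_mem hmem
      have htlp : (tl p).length = p.length - (hd p + 1) := List.length_drop
      have htlq : (tl (p ++ r)).length = (p ++ r).length - (hd (p ++ r) + 1) := List.length_drop
      rw [hidx] at htlq hq2
      rw [List.length_append] at htlq
      have : r.length = 0 := by omega
      rw [List.length_eq_zero_iff.1 this, List.append_nil]
  obtain ⟨c, hc⟩ := hU.optimal M hM
  rintro ⟨b, hb⟩
  -- the prefix of length `g k` has complexity at most `g k - k + 1 + c`, less than `g k - b`
  set k := b + c + 2 with hk
  obtain ⟨m, hm, hmα⟩ := exists_testBit_eq α (g k)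
  have hAm : A (g k) m = true := hα _ m hm hmα
  set v := Nat.count (fun m => A (g k) m = true) m with hv
  have hvlt : v < Nat.count (fun m => A (g k) m = true) (2 ^ g k) := Nat.count_strict_mono hAm hm
  have h4 : 2 ^ (2 * k) * (v + 1) ≤ 2 ^ g k := by
    rw [pow_mul]
    exact (Nat.mul_le_mul_left _ hvlt).trans (hgs k)
  have hle : 2 * k ≤ g k := by
    rw [← Nat.pow_le_pow_iff_right (a := 2) (by norm_num)]
    exact (Nat.le_mul_of_pos_right _ (Nat.succ_pos v)).trans h4
  set u := initialSegment v.testBit (g k - 2 * k) with hu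
  set p : List Bool := List.replicate k true ++ false :: u with hp
  have hhdp : hd p = k := by
    simp only [hd]
    rw [hp, List.idxOf_append_of_notMem (by simp)]; simp
  have htlp : tl p = u := by
    have : tl p = p.drop (hd p + 1) := rfl
    rw [this, hhdp, hp, List.drop_append]; simp
  have hulen : u.length = g k - 2 * k := length_initialSegment _ _
  have hplen : p.length = k + 1 + (g k - 2 * k) := by
    rw [hp, List.length_append, List.length_replicate, List.length_cons, hulen]; ring
  have htestiff : ∀ m', test p m' = true ↔ A (g k) m' = true ∧
      initialSegment (Nat.count (fun m => A (g k) m = true) m').testBit (g k - 2 * k) = u := by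
    intro m'
    simp only [test, hhdp, htlp, hulen, Bool.and_eq_true, decide_eq_true_eq]
    refine ⟨fun h => h.2.2, fun h => ⟨by omega, by omega, h⟩⟩
  have hmem : m ∈ Nat.rfind fun m => Part.some (test p m) := by
    refine Nat.mem_rfind.2 ⟨?_, fun {m'} hm' => ?_⟩
    · rw [(htestiff m).2 ⟨hAm, rfl⟩]; exact Part.mem_some _
    · -- an earlier solution would have a smaller rank with the same digits
      have : test p m' = false := by
        rw [Bool.eq_false_iff, Ne, htestiff]
        rintro ⟨hA', hr⟩
        have hlt : Nat.count (fun m => A (g k) m = true) m' < v := Nat.count_strict_mono hA' hm'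
        have hvb : v < 2 ^ (g k - 2 * k) := by
          have h5 : 2 ^ (2 * k) * (v + 1) ≤ 2 ^ (2 * k) * 2 ^ (g k - 2 * k) := by
            rw [← pow_add, Nat.add_sub_cancel' hle]; exact h4
          exact Nat.le_of_mul_le_mul_left h5 (by positivity)
        refine hlt.ne (Nat.eq_of_testBit_eq fun i => ?_)
        rcases lt_or_ge i (g k - 2 * k) with hi | hi
        · exact initialSegment_injOn hr i hi
        · have h6 : 2 ^ (g k - 2 * k) ≤ 2 ^ i := Nat.pow_le_pow_right (by norm_num) hi
          rw [Nat.testBit_lt_two_pow (hvb.trans_le h6),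
            Nat.testBit_lt_two_pow ((hlt.trans hvb).trans_le h6)]
      rw [this]; exact Part.mem_some _
  have hout : initialSegment α (g k) ∈ M p := by
    have := Part.mem_map (fun m => initialSegment m.testBit (g (hd p))) hmem
    rw [hhdp, initialSegment_congr hmα] at this
    simpa only [M, hhdp] using this
  obtain ⟨q, hq, hqlen⟩ := hc p _ hout
  have h7 : prefixComplexity U (initialSegment α (g k)) ≤ (q.length : ℕ∞) :=
    iInf₂_le q hq
  have h8 : ((g k : ℕ) : ℕ∞) ≤ ((q.length + b : ℕ) : ℕ∞) := by
    push_cast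
    exact (hb (g k)).trans (add_le_add_left h7 _)
  have h9 : g k ≤ q.length + b := by exact_mod_cast h8
  omega

/-! ### Random signs: bounded partial sums are unlikely -/

/-- The partial sum `∑ j < n, ± a j` with signs given by `β`. -/
noncomputable def signSum (β : ℕ → Bool) (a : ℕ → ℝ) (n : ℕ) : ℝ :=
  ∑ j ∈ Finset.range n, rademacher β j * a j

theorem signSum_congr {β γ : ℕ → Bool} (a : ℕ → ℝ) {n : ℕ} (h : ∀ i < n, β i = γ i) :
    signSum β a n = signSum γ a n := by
  refine Finset.sum_congr rfl fun i hi => ?_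
  simp only [rademacher, h i (Finset.mem_range.1 hi)]

theorem abs_rademacher (β : ℕ → Bool) (n : ℕ) : |rademacher β n| = 1 := by
  unfold rademacher; split_ifs <;> simp

theorem signSum_succ (β : ℕ → Bool) (a : ℕ → ℝ) (n : ℕ) :
    signSum β a (n + 1) = signSum β a n + rademacher β n * a n :=
  Finset.sum_range_succ _ _

open Classical in
/-- The sum of `cos (u S_N)` over the sign patterns all of whose partial sums are bounded by `M`.
For `u = 1 / (3 M)` every such pattern contributes at least `1 / 2`. -/
noncomputable def boundedCosSum (a : ℕ → ℝ) (M : ℝ) (N : ℕ) : ℝ :=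
  ∑ m ∈ Finset.range (2 ^ N), if ∀ n ≤ N, |signSum m.testBit a n| ≤ M then
    Real.cos (signSum m.testBit a N / (3 * M)) else 0

theorem half_le_cos_of_abs_le_one {y : ℝ} (hy : |y| ≤ 1) : 1 / 2 ≤ Real.cos y := by
  have h := Real.one_sub_sq_div_two_le_cos (x := y)
  have h2 : y ^ 2 ≤ 1 := (sq_le_one_iff_abs_le_one y).2 hy
  linarith

theorem abs_div_three_mul_le_one {M y : ℝ} (hM : 0 < M) (hy : |y| ≤ 3 * M) :
    |y / (3 * M)| ≤ 1 := by
  rw [abs_div, abs_of_pos (by positivity : 0 < 3 * M)]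
  exact (div_le_one (by positivity)).2 hy

theorem boundedCosSum_nonneg (a : ℕ → ℝ) {M : ℝ} (hM : 0 < M) (N : ℕ) :
    0 ≤ boundedCosSum a M N := by
  refine Finset.sum_nonneg fun m _ => ?_
  split_ifs with h
  · have := half_le_cos_of_abs_le_one (abs_div_three_mul_le_one hM
      ((h N le_rfl).trans (by linarith)))
    linarith
  · exact le_rfl

/-- Averaging over the last sign turns `cos (u S)` into `cos (u S) cos (u a)`; the patterns that
are lost in this step have nonnegative weight. -/
theorem boundedCosSum_succ_le (a : ℕ → ℝ) {M : ℝ} (hM : 0 < M) (N : ℕ) :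
    boundedCosSum a M (N + 1) ≤
      2 * Real.exp (-(2 / Real.pi ^ 2 * (a N / (3 * M)) ^ 2)) * boundedCosSum a M N := by
  classical
  have hlow : ∀ m : ℕ, ∀ n ≤ N, signSum (2 ^ N + m).testBit a n = signSum m.testBit a n :=
    fun m n hn => signSum_congr a fun i hi =>
      Nat.testBit_two_pow_add_gt (lt_of_lt_of_le hi hn) m
  have hall : ∀ m : ℕ, (∀ n ≤ N + 1, |signSum m.testBit a n| ≤ M) ↔
      (∀ n ≤ N, |signSum m.testBit a n| ≤ M) ∧ |signSum m.testBit a (N + 1)| ≤ M := by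
    intro m
    constructor
    · exact fun h => ⟨fun n hn => h n (hn.trans (Nat.le_succ N)), h _ le_rfl⟩
    · rintro ⟨h1, h2⟩ n hn
      rcases Nat.le_or_eq_of_le_succ hn with h | h
      · exact h1 n h
      · rw [h]; exact h2
  rcases lt_or_ge (2 * M) |a N| with hbig | hsmall
  · -- a term exceeding `2 M` cannot join two partial sums bounded by `M`
    have h0 : boundedCosSum a M (N + 1) = 0 := by
      refine Finset.sum_eq_zero fun m _ => if_neg fun h => ?_
      have h1 := abs_le.1 (h N (Nat.le_succ N))
      have h2 := abs_le.1 (h (N + 1) le_rfl)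
      rw [signSum_succ] at h2
      have h3 : |rademacher m.testBit N * a N| ≤ 2 * M := by
        rw [abs_le]; constructor <;> linarith
      rw [abs_mul, abs_rademacher, one_mul] at h3
      linarith
    rw [h0]
    exact mul_nonneg (by positivity) (boundedCosSum_nonneg a hM N)
  · have hcos : Real.cos (a N / (3 * M)) ≤
        Real.exp (-(2 / Real.pi ^ 2 * (a N / (3 * M)) ^ 2)) := by
      have h1 : |a N / (3 * M)| ≤ Real.pi :=
        (abs_div_three_mul_le_one hM (by linarith)).trans (by linarith [Real.pi_gt_three])
      have h2 := Real.cos_le_one_sub_mul_cos_sq h1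
      have h3 := Real.add_one_le_exp (-(2 / Real.pi ^ 2 * (a N / (3 * M)) ^ 2))
      linarith
    have hstep : boundedCosSum a M (N + 1) ≤
        2 * Real.cos (a N / (3 * M)) * boundedCosSum a M N := by
      unfold boundedCosSum
      rw [show (2 : ℕ) ^ (N + 1) = 2 ^ N + 2 ^ N by ring, Finset.sum_range_add,
        ← Finset.sum_add_distrib, Finset.mul_sum]
      refine Finset.sum_le_sum fun m hm => ?_
      have hm' : m.testBit N = false := Nat.testBit_lt_two_pow (Finset.mem_range.1 hm)
      have hm'' : (2 ^ N + m).testBit N = true := by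
        rw [Nat.testBit_two_pow_add_eq, hm']; rfl
      simp only [hall]
      rw [signSum_succ, signSum_succ, hlow m N le_rfl]
      have e1 : rademacher m.testBit N = -1 := by simp [rademacher, hm']
      have e2 : rademacher (2 ^ N + m).testBit N = 1 := by simp [rademacher, hm'']
      rw [e1, e2]
      have hiff : (∀ n ≤ N, |signSum (2 ^ N + m).testBit a n| ≤ M) ↔
          (∀ n ≤ N, |signSum m.testBit a n| ≤ M) :=
        forall₂_congr fun n hn => by rw [hlow m n hn]
      by_cases hB : ∀ n ≤ N, |signSum m.testBit a n| ≤ M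
      · rw [if_pos hB]
        set S := signSum m.testBit a N with hS
        have hSM : |S| ≤ M := hB N le_rfl
        have hpos : ∀ y : ℝ, |y| ≤ 2 * M → 0 ≤ Real.cos ((S + y) / (3 * M)) := by
          intro y hy
          have := half_le_cos_of_abs_le_one (abs_div_three_mul_le_one hM
            ((abs_add_le S y).trans (by linarith)))
          linarith
        refine (add_le_add (b := Real.cos ((S + -1 * a N) / (3 * M)))
          (d := Real.cos ((S + 1 * a N) / (3 * M))) ?_ ?_).trans (le_of_eq ?_)
        · split_ifs
          · exact le_rfl
          · exact hpos _ (by rwa [abs_mul, abs_neg, abs_one, one_mul])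
        · split_ifs
          · exact le_rfl
          · exact hpos _ (by rwa [one_mul])
        · rw [show (S + -1 * a N) / (3 * M) = S / (3 * M) - a N / (3 * M) by ring,
            show (S + 1 * a N) / (3 * M) = S / (3 * M) + a N / (3 * M) by ring,
            Real.cos_sub, Real.cos_add]
          ring
      · rw [if_neg fun h => hB h.1, if_neg fun h => hB (hiff.1 h.1), if_neg hB, add_zero,
          mul_zero]
    refine hstep.trans ?_
    have := boundedCosSum_nonneg a hM N
    gcongr

theorem boundedCosSum_le (a : ℕ → ℝ) {M : ℝ} (hM : 0 < M) (N : ℕ) :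
    boundedCosSum a M N ≤ 2 ^ N *
      Real.exp (-(2 / (Real.pi * (3 * M)) ^ 2 * ∑ j ∈ Finset.range N, a j ^ 2)) := by
  induction N with
  | zero => simp [boundedCosSum, signSum, hM.le]
  | succ N ih =>
    refine (boundedCosSum_succ_le a hM N).trans ?_
    refine (mul_le_mul_of_nonneg_left ih (by positivity)).trans (le_of_eq ?_)
    rw [Finset.sum_range_succ, mul_add, neg_add, Real.exp_add, pow_succ (2 : ℝ),
      show 2 / Real.pi ^ 2 * (a N / (3 * M)) ^ 2 = 2 / (Real.pi * (3 * M)) ^ 2 * a N ^ 2 by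
        rw [mul_pow, div_pow]; field_simp]
    ring

/-- Among the `2 ^ N` sign patterns, those whose partial sums of `∑ ± a j` stay bounded by `M` are
exponentially rare in `∑ a j ^ 2`. -/
theorem card_bounded_signSum_le (a : ℕ → ℝ) {M : ℝ} (hM : 0 < M) (N : ℕ) (S : Finset ℕ)
    (hS : ∀ m ∈ S, m < 2 ^ N ∧ ∀ n ≤ N, |signSum m.testBit a n| ≤ M) :
    (S.card : ℝ) ≤ 2 * 2 ^ N *
      Real.exp (-(2 / (Real.pi * (3 * M)) ^ 2 * ∑ j ∈ Finset.range N, a j ^ 2)) := by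
  have h : (S.card : ℝ) * (1 / 2) ≤ boundedCosSum a M N := by
    unfold boundedCosSum
    rw [← nsmul_eq_mul, ← Finset.sum_const]
    refine (Finset.sum_le_sum fun m hm => ?_).trans (Finset.sum_le_sum_of_subset_of_nonneg
      (fun m hm => Finset.mem_range.2 (hS m hm).1) fun m _ _ => ?_)
    · rw [if_pos (hS m hm).2]
      exact half_le_cos_of_abs_le_one (abs_div_three_mul_le_one hM
        (((hS m hm).2 N le_rfl).trans (by linarith)))
    · split_ifs with h
      · have := half_le_cos_of_abs_le_one (abs_div_three_mul_le_one hM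
          ((h N le_rfl).trans (by linarith)))
        linarith
      · exact le_rfl
  have := boundedCosSum_le a hM N
  linarith

/-! ### The variance diverges almost everywhere -/

theorem integrableOn_of_continuous_of_bounded {f : ℝ → ℝ} (hf : Continuous f) {C : ℝ}
    (hC : ∀ s, |f s| ≤ C) {T : Set ℝ} (hT : volume T ≠ ⊤) : IntegrableOn f T := by
  have : IsFiniteMeasure (volume.restrict T) := ⟨by simpa using hT.lt_top⟩
  exact Integrable.of_bound hf.aestronglyMeasurable C (Eventually.of_forall hC)

/-- By the Riemann-Lebesgue lemma, high frequency cosines with arbitrary phases average to `0` over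
every set of finite measure. -/
theorem tendsto_setIntegral_cos_nat_mul (ψ : ℕ → ℝ) {T : Set ℝ} (hT : MeasurableSet T)
    (hfin : volume T ≠ ⊤) :
    Tendsto (fun j : ℕ => ∫ s in T, Real.cos (2 * (j * s) + ψ j)) atTop (𝓝 0) := by
  have hRL := Real.tendsto_integral_exp_smul_cocompact (T.indicator fun _ => (1 : ℂ))
  have hw : Tendsto (fun j : ℕ => -((j : ℝ) / Real.pi)) atTop (cocompact ℝ) := by
    refine (tendsto_neg_atTop_atBot.comp
      (tendsto_natCast_atTop_atTop.atTop_div_const Real.pi_pos)).mono_right ?_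
    exact atBot_le_cocompact
  have h1 := (hRL.comp hw).norm
  rw [norm_zero] at h1
  refine squeeze_zero_norm (fun j => ?_) h1
  have e1 : ∀ s : ℝ, ((Real.fourierChar (-(s * -((j : ℝ) / Real.pi))) : Circle) : ℂ) =
      Complex.exp (((2 * (j * s) : ℝ) : ℂ) * Complex.I) := by
    intro s
    rw [Real.fourierChar_apply]
    congr 3
    field_simp
  have e2 : (∫ v : ℝ, Real.fourierChar (-(v * -((j : ℝ) / Real.pi))) •
      (T.indicator (fun _ => (1 : ℂ)) v)) =
      ∫ s in T, Complex.exp (((2 * (j * s) : ℝ) : ℂ) * Complex.I) := by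
    rw [← integral_indicator hT]
    congr 1
    ext s
    rw [Circle.smul_def, e1]
    by_cases hs : s ∈ T <;> simp [hs]
  have hint : Integrable (fun s : ℝ => Complex.exp ((ψ j : ℂ) * Complex.I) *
      Complex.exp (((2 * (j * s) : ℝ) : ℂ) * Complex.I)) (volume.restrict T) := by
    have : IsFiniteMeasure (volume.restrict T) := ⟨by simpa using hfin.lt_top⟩
    refine Integrable.of_bound (Continuous.aestronglyMeasurable (by fun_prop)) 1
      (Eventually.of_forall fun s => ?_)
    rw [norm_mul, Complex.norm_exp_ofReal_mul_I, Complex.norm_exp_ofReal_mul_I, one_mul]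
  have e3 : ∫ s in T, Real.cos (2 * (j * s) + ψ j) =
      (Complex.exp ((ψ j : ℂ) * Complex.I) *
        ∫ s in T, Complex.exp (((2 * (j * s) : ℝ) : ℂ) * Complex.I)).re := by
    rw [← integral_const_mul]
    rw [← RCLike.re_eq_complex_re, ← integral_re hint]
    refine integral_congr_ae (Eventually.of_forall fun s => ?_)
    simp only [RCLike.re_eq_complex_re]
    rw [← Complex.exp_add, ← Complex.exp_ofReal_mul_I_re]
    congr 2
    push_cast
    ring
  rw [e3, Real.norm_eq_abs]
  refine (Complex.abs_re_le_norm _).trans ?_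
  rw [norm_mul, Complex.norm_exp_ofReal_mul_I, one_mul, Function.comp_apply, ← e2]

/-- On a set where the variances stay bounded, `∑ x j ^ 2 ∫ cos ^ 2` converges, although the
integrals tend to half the measure of the set; so that set is null. -/
theorem volume_eq_zero_of_sum_sq_cos_le {x φ : ℕ → ℝ}
    (hsum : Tendsto (fun N : ℕ => ∑ n ∈ Finset.range N, x n ^ 2) atTop atTop) {T : Set ℝ}
    (hT : MeasurableSet T) (hfin : volume T ≠ ⊤) {C : ℝ}
    (hC : ∀ s ∈ T, ∀ N, ∑ j ∈ Finset.range N, (x j * Real.cos (j * s + φ j)) ^ 2 ≤ C) :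
    volume T = 0 := by
  by_contra hne
  have hc : 0 < volume.real T := by
    rw [Measure.real, ENNReal.toReal_pos_iff]
    exact ⟨pos_iff_ne_zero.2 hne, hfin.lt_top⟩
  set c := volume.real T with hcdef
  have hicos : ∀ j : ℕ, IntegrableOn (fun s : ℝ => Real.cos (j * s + φ j) ^ 2) T := fun j =>
    integrableOn_of_continuous_of_bounded (by fun_prop) (C := 1) (fun s => by
      rw [abs_of_nonneg (sq_nonneg _)]; exact Real.cos_sq_le_one _) hfin
  have hlim := tendsto_setIntegral_cos_nat_mul (fun j => 2 * φ j) hT hfin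
  obtain ⟨J, hJ⟩ :=
    (hlim.eventually (Ioi_mem_nhds (by linarith : -(c / 2) < 0))).exists_forall_of_atTop
  have hhalf : ∀ j ≥ J, c / 4 ≤ ∫ s in T, Real.cos (j * s + φ j) ^ 2 := by
    intro j hj
    have e : ∀ s : ℝ, Real.cos (j * s + φ j) ^ 2 =
        1 / 2 + Real.cos (2 * (j * s) + 2 * φ j) / 2 := by
      intro s; rw [Real.cos_sq]; ring_nf
    have hi : IntegrableOn (fun s : ℝ => Real.cos (2 * (j * s) + 2 * φ j) / 2) T :=
      integrableOn_of_continuous_of_bounded (by fun_prop) (C := 1) (fun s => by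
        rw [abs_div, abs_two]; linarith [Real.abs_cos_le_one (2 * (j * s) + 2 * φ j)]) hfin
    simp_rw [e]
    rw [integral_add (integrableOn_const (C := (1 / 2 : ℝ)) hfin) hi, setIntegral_const,
      integral_div, ← hcdef, smul_eq_mul]
    have h2 : -(c / 2) < ∫ s in T, Real.cos (2 * (j * s) + 2 * φ j) := hJ j hj
    linarith
  have hbound : ∀ N ≥ J, (∑ j ∈ Finset.range N, x j ^ 2) ≤
      4 * C + ∑ j ∈ Finset.range J, x j ^ 2 := by
    intro N hN
    have h1 : ∫ s in T, ∑ j ∈ Finset.range N, (x j * Real.cos (j * s + φ j)) ^ 2 ≤ C * c := by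
      have hi : IntegrableOn
          (fun s : ℝ => ∑ j ∈ Finset.range N, (x j * Real.cos (j * s + φ j)) ^ 2) T := by
        refine integrable_finsetSum _ fun j _ => ?_
        simp_rw [mul_pow]
        exact (hicos j).const_mul _
      refine (setIntegral_mono_on hi (integrableOn_const (C := C) hfin) hT
        fun s hs => hC s hs N).trans (le_of_eq ?_)
      rw [setIntegral_const, smul_eq_mul, mul_comm]
    have h2 : ∫ s in T, ∑ j ∈ Finset.range N, (x j * Real.cos (j * s + φ j)) ^ 2 =
        ∑ j ∈ Finset.range N, x j ^ 2 * ∫ s in T, Real.cos (j * s + φ j) ^ 2 := by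
      simp_rw [mul_pow]
      rw [integral_finsetSum _ fun j _ => (hicos j).const_mul _]
      simp_rw [integral_const_mul]
    have h3 : ∑ j ∈ Finset.Ico J N, x j ^ 2 * (c / 4) ≤
        ∑ j ∈ Finset.range N, x j ^ 2 * ∫ s in T, Real.cos (j * s + φ j) ^ 2 := by
      refine (Finset.sum_le_sum fun j hj => mul_le_mul_of_nonneg_left
        (hhalf j (Finset.mem_Ico.1 hj).1) (sq_nonneg _)).trans
        (Finset.sum_le_sum_of_subset_of_nonneg (fun j hj => ?_) fun j _ _ => ?_)
      · exact Finset.mem_range.2 (Finset.mem_Ico.1 hj).2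
      · exact mul_nonneg (sq_nonneg _) (integral_nonneg fun s => sq_nonneg _)
    rw [← Finset.sum_mul] at h3
    rw [h2] at h1
    have h4 : (∑ j ∈ Finset.Ico J N, x j ^ 2) ≤ 4 * C := by
      have h5 := h3.trans h1
      have h6 : (∑ j ∈ Finset.Ico J N, x j ^ 2) * (c / 4) ≤ (4 * C) * (c / 4) := by linarith
      exact le_of_mul_le_mul_right h6 (by positivity)
    rw [← Finset.sum_range_add_sum_Ico _ hN]
    linarith
  obtain ⟨N, hN, hJN⟩ := ((hsum.eventually (eventually_gt_atTop
    (4 * C + ∑ j ∈ Finset.range J, x j ^ 2))).and (eventually_ge_atTop J)).exists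
  exact absurd (hbound N hJN) (not_le.2 hN)

theorem ae_tendsto_sum_sq_cos {x : ℕ → ℝ} (φ : ℕ → ℝ)
    (hsum : Tendsto (fun N : ℕ => ∑ n ∈ Finset.range N, x n ^ 2) atTop atTop) :
    ∀ᵐ s : ℝ, Tendsto (fun N : ℕ => ∑ j ∈ Finset.range N, (x j * Real.cos (j * s + φ j)) ^ 2)
      atTop atTop := by
  -- the exceptional set is a countable union of sets with bounded variances
  have hT : ∀ C R : ℕ, volume (Set.Icc (-(R : ℝ)) R ∩ {s : ℝ | ∀ N : ℕ,
      ∑ j ∈ Finset.range N, (x j * Real.cos (j * s + φ j)) ^ 2 ≤ C}) = 0 := by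
    intro C R
    refine volume_eq_zero_of_sum_sq_cos_le (φ := φ) (C := C) hsum
      (measurableSet_Icc.inter ?_) ?_ fun s hs => hs.2
    · rw [Set.ofPred_forall]
      exact MeasurableSet.iInter fun N => measurableSet_le
        (Continuous.measurable (by fun_prop)) measurable_const
    · exact ((measure_mono Set.inter_subset_left).trans_lt measure_Icc_lt_top).ne
  rw [ae_iff]
  refine measure_mono_null (fun s hs => ?_) (measure_iUnion_null fun C : ℕ =>
    measure_iUnion_null fun R : ℕ => hT C R)
  have hmono : Monotone fun N : ℕ =>
      ∑ j ∈ Finset.range N, (x j * Real.cos (j * s + φ j)) ^ 2 :=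
    monotone_nat_of_le_succ fun N => by
      rw [Finset.sum_range_succ]; linarith [sq_nonneg (x N * Real.cos (N * s + φ N))]
  have hb : ∃ b : ℝ, ∀ N : ℕ, ∑ j ∈ Finset.range N, (x j * Real.cos (j * s + φ j)) ^ 2 < b := by
    by_contra! h
    exact hs (tendsto_atTop_atTop_of_monotone hmono h)
  obtain ⟨b, hb⟩ := hb
  obtain ⟨C, hC⟩ := exists_nat_ge b
  obtain ⟨R, hR⟩ := exists_nat_ge |s|
  exact Set.mem_iUnion.2 ⟨C, Set.mem_iUnion.2 ⟨R, abs_le.1 hR, fun N => (hb N).le.trans hC⟩⟩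

theorem tendsto_integral_exp_neg_sum_sq_cos {x : ℕ → ℝ} (φ : ℕ → ℝ)
    (hsum : Tendsto (fun N : ℕ => ∑ n ∈ Finset.range N, x n ^ 2) atTop atTop) {c : ℝ}
    (hc : 0 < c) (R : ℝ) :
    Tendsto (fun N : ℕ => ∫ s in (0 : ℝ)..R,
      Real.exp (-(c * ∑ j ∈ Finset.range N, (x j * Real.cos (j * s + φ j)) ^ 2)))
      atTop (𝓝 0) := by
  have h := intervalIntegral.tendsto_integral_filter_of_dominated_convergence (a := 0) (b := R)
    (μ := volume) (l := atTop) (f := fun _ => (0 : ℝ))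
    (F := fun (N : ℕ) (s : ℝ) =>
      Real.exp (-(c * ∑ j ∈ Finset.range N, (x j * Real.cos (j * s + φ j)) ^ 2)))
    (fun _ => 1) (Eventually.of_forall fun N => Continuous.aestronglyMeasurable (by fun_prop))
    (Eventually.of_forall fun N => Eventually.of_forall fun s _ => ?_)
    intervalIntegrable_const ?_
  · simpa using h
  · rw [Real.norm_eq_abs, Real.abs_exp, Real.exp_le_one_iff, neg_nonpos]
    exact mul_nonneg hc.le (Finset.sum_nonneg fun j _ => sq_nonneg _)
  · filter_upwards [ae_tendsto_sum_sq_cos φ hsum] with s hs _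
    exact Real.tendsto_exp_neg_atTop_nhds_zero.comp (hs.const_mul_atTop hc)

/-! ### Discretizing the trigonometric series -/

/-- The `j`-th term `x j cos (j s + φ j)` of the series, without its sign. -/
noncomputable def trigTerm (x φ : ℕ → ℝ) (s : ℝ) (j : ℕ) : ℝ := x j * Real.cos (j * s + φ j)

theorem abs_signSum_trigTerm_sub_le (β : ℕ → Bool) {x φ : ℕ → ℝ} {B : ℕ → ℕ}
    (hB : ∀ j, |x j| ≤ B j) {n N : ℕ} (hn : n ≤ N) (s t : ℝ) :
    |signSum β (trigTerm x φ s) n - signSum β (trigTerm x φ t) n| ≤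
      ((∑ j ∈ Finset.range N, B j * j : ℕ) : ℝ) * |s - t| := by
  unfold signSum
  rw [← Finset.sum_sub_distrib]
  refine (Finset.abs_sum_le_sum_abs _ _).trans ?_
  push_cast
  rw [Finset.sum_mul]
  refine (Finset.sum_le_sum_of_subset_of_nonneg (Finset.range_mono hn)
    fun j _ _ => abs_nonneg _).trans (Finset.sum_le_sum fun j _ => ?_)
  rw [← mul_sub, abs_mul, abs_rademacher, one_mul, trigTerm, trigTerm, ← mul_sub, abs_mul,
    mul_assoc]
  refine mul_le_mul (hB j) ?_ (abs_nonneg _) (Nat.cast_nonneg _)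
  refine (Real.abs_cos_sub_cos_le _ _).trans (le_of_eq ?_)
  rw [show (j : ℝ) * s + φ j - (j * t + φ j) = j * (s - t) by ring, abs_mul, Nat.abs_cast]

/-- Boundedness of the first partial sums at the grid points `i / (G N + 1)` can be decided up to a
tolerance, uniformly in the grid and in the signs. -/
theorem exists_gridTest {x φ : ℕ → ℝ} (hx : IsComputableRealSeq x) (hφ : IsComputableRealSeq φ)
    {G : ℕ → ℕ} (hG : Computable G) (K : ℕ) :
    ∃ E : ℕ × ℕ → ℕ → Bool, Computable₂ E ∧ ∀ N m i : ℕ,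
      ((∀ n ≤ N, |signSum m.testBit (trigTerm x φ (i / (G N + 1))) n| ≤ K) →
        E (N, m) i = true) ∧
      (E (N, m) i = true →
        ∀ n ≤ N, |signSum m.testBit (trigTerm x φ (i / (G N + 1))) n| ≤ K + 1) := by
  -- the arguments `((N, m), i), n` of the partial sums, followed by the summation index `j`
  have cj : Computable fun p : ((((ℕ × ℕ) × ℕ) × ℕ) × ℕ) => p.2 := Computable.snd
  have ci : Computable fun p : ((((ℕ × ℕ) × ℕ) × ℕ) × ℕ) => p.1.1.2 :=
    Computable.snd.comp (Computable.fst.comp Computable.fst)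
  have cNm : Computable fun p : ((((ℕ × ℕ) × ℕ) × ℕ) × ℕ) => p.1.1.1 :=
    Computable.fst.comp (Computable.fst.comp Computable.fst)
  have hsign : IsComputableRealFun fun p : ((((ℕ × ℕ) × ℕ) × ℕ) × ℕ) =>
      RatCode.val (bif p.1.1.1.2.testBit p.2 then (1, 0, 0) else (0, 1, 0)) :=
    IsComputableRealFun.of_ratCode (Computable.cond
      (Primrec.testBit.to_comp.comp (Computable.snd.comp cNm) cj)
      (Computable.const (1, 0, 0)) (Computable.const (0, 1, 0)))
  have harg : IsComputableRealFun fun p : ((((ℕ × ℕ) × ℕ) × ℕ) × ℕ) =>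
      RatCode.val (p.2 * p.1.1.2, 0, G p.1.1.1.1) :=
    IsComputableRealFun.of_ratCode ((cj.natMul ci).pair ((Computable.const 0).pair
      (hG.comp (Computable.fst.comp cNm))))
  have hS := IsComputableRealFun.sum
    (f := fun (p : ((ℕ × ℕ) × ℕ) × ℕ) j =>
      RatCode.val (bif p.1.1.2.testBit j then (1, 0, 0) else (0, 1, 0)) *
        (x j * Real.cos (RatCode.val (j * p.1.2, 0, G p.1.1.1) + φ j)))
    (g := fun p => p.2)
    (hsign.mul ((hx.isComputableRealFun.comp cj).mul
      (harg.add (hφ.isComputableRealFun.comp cj)).cos)) Computable.snd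
  obtain ⟨P, hP, hPs⟩ := hS.exists_decide_abs_le K
  have hval : ∀ N m i n : ℕ, (∑ j ∈ Finset.range n,
      RatCode.val (bif m.testBit j then (1, 0, 0) else (0, 1, 0)) *
        (x j * Real.cos (RatCode.val (j * i, 0, G N) + φ j))) =
      signSum m.testBit (trigTerm x φ (i / (G N + 1))) n := by
    intro N m i n
    refine Finset.sum_congr rfl fun j _ => ?_
    have e1 : RatCode.val (bif m.testBit j then (1, 0, 0) else (0, 1, 0)) =
        rademacher m.testBit j := by
      unfold rademacher
      cases m.testBit j <;> simp [RatCode.val]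
    have e2 : RatCode.val (j * i, 0, G N) = j * (i / (G N + 1)) := by
      simp only [RatCode.val]; push_cast; ring
    rw [e1, e2, trigTerm]
  have hcount : Computable₂ fun (q : ℕ × ℕ) (i : ℕ) =>
      Nat.count (fun n => P ((q, i), n) = true) (q.1 + 1) :=
    Computable.natCount (β := (ℕ × ℕ) × ℕ) (f := fun p n => P (p, n)) hP
      ((Computable.fst.comp Computable.fst).natAdd (Computable.const 1))
  refine ⟨fun q i => decide (Nat.count (fun n => P ((q, i), n) = true) (q.1 + 1) = q.1 + 1),
    Computable.decideEq hcount
      ((Computable.fst.comp Computable.fst).natAdd (Computable.const 1)), fun N m i => ?_⟩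
  rw [decide_eq_true_eq, Nat.count_iff_forall]
  simp only [Nat.lt_succ_iff]
  refine ⟨fun h n hn => (hPs (((N, m), i), n)).1 ?_, fun h n hn => ?_⟩
  · simp only [hval]; exact h n hn
  · have := (hPs (((N, m), i), n)).2 (h n hn)
    simpa only [hval] using this

/-- A set covered by cells `[i / G, (i + 1) / G]` with `i ∈ I` has measure at most `#I / G`. -/
theorem volume_le_card_div {T : Set ℝ} {G : ℝ} (I : Finset ℕ)
    (hT : ∀ s ∈ T, ∃ i ∈ I, s ∈ Set.Icc ((i : ℝ) / G) ((i + 1) / G)) :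
    volume T ≤ ENNReal.ofReal (I.card / G) := by
  have h1 : T ⊆ ⋃ i ∈ I, Set.Icc ((i : ℝ) / G) ((i + 1) / G) := fun s hs => by
    obtain ⟨i, hi, h⟩ := hT s hs
    exact Set.mem_iUnion₂.2 ⟨i, hi, h⟩
  refine (measure_mono h1).trans ((measure_biUnion_finset_le _ _).trans (le_of_eq ?_))
  have h2 : ∀ i : ℕ, volume (Set.Icc ((i : ℝ) / G) ((i + 1) / G)) = ENNReal.ofReal (1 / G) := by
    intro i
    rw [Real.volume_Icc]; congr 1; ring
  simp_rw [h2]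
  rw [Finset.sum_const, nsmul_eq_mul, ← ENNReal.ofReal_natCast, ← ENNReal.ofReal_mul
    (Nat.cast_nonneg _), mul_one_div]

/-- A lower Riemann sum over the cells `[i / G, (i + 1) / G]` is at most the integral. -/
theorem sum_div_le_integral {f : ℝ → ℝ} (hf : Continuous f) {G : ℝ} (hG : 0 < G) {b : ℕ → ℝ}
    {n : ℕ} (hb : ∀ i < n, ∀ s ∈ Set.Icc ((i : ℝ) / G) ((i + 1) / G), b i ≤ f s) :
    ∑ i ∈ Finset.range n, b i / G ≤ ∫ s in (0 : ℝ)..(n / G), f s := by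
  have h := intervalIntegral.sum_integral_adjacent_intervals (μ := volume) (f := f)
    (a := fun i : ℕ => (i : ℝ) / G) (n := n) fun k _ => hf.intervalIntegrable _ _
  simp only [Nat.cast_zero, zero_div] at h
  rw [← h]
  refine Finset.sum_le_sum fun i hi => ?_
  have hle : (i : ℝ) / G ≤ ((i + 1 : ℕ) : ℝ) / G := by
    push_cast; gcongr; linarith
  have h2 := intervalIntegral.integral_mono_on hle (f := fun _ => b i) (g := f)
    (intervalIntegrable_const (μ := volume)) (hf.intervalIntegrable _ _) (fun s hs =>
      hb i (Finset.mem_range.1 hi) s (by simpa using hs))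
  rw [intervalIntegral.integral_const, smul_eq_mul] at h2
  refine le_trans (le_of_eq ?_) h2
  push_cast
  ring

/-- The test against `α`: the strings of length `N` whose partial sums are bounded on a fixed
fraction of the grid are decidable, they include the prefixes of `α` when the partial sums
for `α` are bounded on a set of positive measure, and they are rare because the variances diverge
almost everywhere. -/
theorem volume_bounded_partialSums_eq_zero {U : List Bool →. List Bool}
    (hU : IsOptimalPrefixMachine U) {x φ : ℕ → ℝ} (hx : IsComputableRealSeq x)
    (hφ : IsComputableRealSeq φ)
    (hsum : Tendsto (fun N : ℕ => ∑ n ∈ Finset.range N, x n ^ 2) atTop atTop)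
    {α : ℕ → Bool} (hα : IsKC U α) (M R : ℕ) :
    volume {s ∈ Set.Ico (0 : ℝ) R | ∀ n, |signSum α (trigTerm x φ s) n| ≤ M} = 0 := by
  set T := {s ∈ Set.Ico (0 : ℝ) R | ∀ n, |signSum α (trigTerm x φ s) n| ≤ M} with hTdef
  by_contra hT
  obtain ⟨Q, hQ⟩ := ENNReal.exists_inv_nat_lt hT
  obtain ⟨B, hB, hxB⟩ := hx.isComputableRealFun.exists_bound
  -- with `L N + 1` grid points per unit length, neighbouring values differ by at most `1`
  let L : ℕ → ℕ := fun N => ∑ j ∈ Finset.range N, B j * j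
  have hL : Computable L := Computable.natSum (f := fun _ j => B j * j)
    ((hB.comp Computable.snd).natMul Computable.snd) Computable.id
  have hLpos : ∀ N, (0 : ℝ) < L N + 1 := fun N => by positivity
  have hclose : ∀ (β : ℕ → Bool) (N i : ℕ) (s t : ℝ),
      s ∈ Set.Icc ((i : ℝ) / (L N + 1)) ((i + 1) / (L N + 1)) →
      t ∈ Set.Icc ((i : ℝ) / (L N + 1)) ((i + 1) / (L N + 1)) → ∀ n ≤ N, ∀ C : ℝ,
      |signSum β (trigTerm x φ s) n| ≤ C → |signSum β (trigTerm x φ t) n| ≤ C + 1 := by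
    intro β N i s t hs ht n hn C hC
    have h1 := abs_signSum_trigTerm_sub_le (φ := φ) β hxB hn t s
    have h2 : |t - s| ≤ 1 / (L N + 1) := by
      have h3 : ((i : ℝ) + 1) / (L N + 1) = i / (L N + 1) + 1 / (L N + 1) := by ring
      rw [abs_le]
      constructor <;> linarith [hs.1, hs.2, ht.1, ht.2]
    have h4 : (L N : ℝ) * |t - s| ≤ 1 := by
      refine (mul_le_mul_of_nonneg_left h2 (Nat.cast_nonneg _)).trans ?_
      rw [mul_one_div, div_le_one (hLpos N)]
      linarith
    have h5 := abs_add_le (signSum β (trigTerm x φ t) n - signSum β (trigTerm x φ s) n)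
      (signSum β (trigTerm x φ s) n)
    rw [sub_add_cancel] at h5
    linarith
  have hleft : ∀ N i : ℕ, (i : ℝ) / (L N + 1) ∈
      Set.Icc ((i : ℝ) / (L N + 1)) ((i + 1) / (L N + 1)) := fun N i =>
    ⟨le_rfl, by gcongr; linarith⟩
  obtain ⟨E, hE, hEs⟩ := exists_gridTest hx hφ hL (M + 1)
  let cells : ℕ → ℕ → ℕ := fun N m => Nat.count (fun i => E (N, m) i = true) (R * (L N + 1))
  let A : ℕ → ℕ → Bool := fun N m => decide (L N + 1 ≤ Q * cells N m)
  have hL1 : Computable fun p : ℕ × ℕ => L p.1 + 1 :=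
    (hL.comp Computable.fst).natAdd (Computable.const 1)
  have hA : Computable₂ A := hL1.decideNatLe ((Computable.const Q).natMul
    (Computable.natCount (β := ℕ × ℕ) hE ((Computable.const R).natMul hL1)))
  refine not_isKC_of_decidable_null hU hA (fun k => ?_) (fun N m hm hmα => ?_) hα
  · -- a tolerance of `1` on the bound `M` is lost from a point to the grid, one in the decision,
    -- and one from the grid back to the cell, whence `M + 3`
    set c : ℝ := 2 / (Real.pi * (3 * (M + 3))) ^ 2 with hc
    have hcpos : 0 < c := by positivity
    have hlim := tendsto_integral_exp_neg_sum_sq_cos φ hsum hcpos R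
    have hQ4 : (0 : ℝ) < 1 / (4 ^ k * (2 * (Q + 1))) := by positivity
    obtain ⟨N, hN⟩ := (hlim.eventually (Iio_mem_nhds hQ4)).exists
    set I := ∫ s in (0 : ℝ)..R,
      Real.exp (-(c * ∑ j ∈ Finset.range N, (x j * Real.cos (j * s + φ j)) ^ 2)) with hI
    have hN' : 4 ^ k * (2 * (Q + 1)) * I ≤ 1 := by
      rw [mul_comm]; exact (le_div_iff₀ (by positivity)).1 (le_of_lt hN)
    refine ⟨N, ?_⟩
    set D := Nat.count (fun m => A N m = true) (2 ^ N) with hD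
    let w : ℕ → ℝ := fun i =>
      (((Finset.range (2 ^ N)).filter fun m => E (N, m) i = true).card : ℝ)
    have hw : ∑ i ∈ Finset.range (R * (L N + 1)), w i / (L N + 1) ≤ 2 * 2 ^ N * I := by
      have h1 := sum_div_le_integral (n := R * (L N + 1)) (b := w) (G := L N + 1)
        (f := fun s => 2 * 2 ^ N * Real.exp (-(c * ∑ j ∈ Finset.range N,
          (x j * Real.cos (j * s + φ j)) ^ 2))) (by fun_prop) (hLpos N)
        (fun i _ s hs => card_bounded_signSum_le (trigTerm x φ s) (M := M + 3) (by positivity)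
          N _ fun m hm => ?_)
      · rw [intervalIntegral.integral_const_mul] at h1
        push_cast at h1
        rwa [mul_div_cancel_right₀ _ (hLpos N).ne'] at h1
      · rw [Finset.mem_filter, Finset.mem_range] at hm
        refine ⟨hm.1, fun n hn => ?_⟩
        have h2 := hclose m.testBit N i _ s (hleft N i) hs n hn _ ((hEs N m i).2 hm.2 n hn)
        refine h2.trans (le_of_eq ?_)
        push_cast; ring
    -- double counting of the pairs of a string and a cell
    have hdouble : (D : ℝ) * (L N + 1) ≤
        Q * ∑ i ∈ Finset.range (R * (L N + 1)), w i := by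
      have h1 : D * (L N + 1) ≤ ∑ m ∈ Finset.range (2 ^ N), Q * cells N m := by
        rw [hD, Nat.count_eq_card_filter_range, ← smul_eq_mul, ← Finset.sum_const]
        refine (Finset.sum_le_sum fun m hm => ?_).trans
          (Finset.sum_le_sum_of_subset (Finset.filter_subset _ _))
        exact of_decide_eq_true (Finset.mem_filter.1 hm).2
      have h2 : ∑ m ∈ Finset.range (2 ^ N), cells N m = ∑ i ∈ Finset.range (R * (L N + 1)),
          ((Finset.range (2 ^ N)).filter fun m => E (N, m) i = true).card := by
        simp only [cells, Nat.count_eq_card_filter_range, Finset.card_filter]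
        exact Finset.sum_comm
      rw [← Finset.mul_sum, h2] at h1
      simp only [w]
      exact_mod_cast h1
    have hDle : (D : ℝ) ≤ Q * (2 * 2 ^ N * I) := by
      refine le_trans ?_ (mul_le_mul_of_nonneg_left hw (Nat.cast_nonneg Q))
      rw [← Finset.sum_div, mul_div_assoc', le_div_iff₀ (hLpos N)]
      exact hdouble
    have hI0 : 0 ≤ I := intervalIntegral.integral_nonneg (Nat.cast_nonneg R)
      fun s _ => (Real.exp_pos _).le
    have : (4 : ℝ) ^ k * D ≤ 2 ^ N := by
      calc (4 : ℝ) ^ k * D ≤ 4 ^ k * (Q * (2 * 2 ^ N * I)) := by gcongr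
        _ ≤ 4 ^ k * ((Q + 1) * (2 * 2 ^ N * I)) := by gcongr; linarith
        _ = 2 ^ N * (4 ^ k * (2 * (Q + 1)) * I) := by ring
        _ ≤ 2 ^ N * 1 := by gcongr
        _ = 2 ^ N := mul_one _
    exact_mod_cast this
  · -- the prefixes of `α` pass the test
    have hcover := volume_le_card_div (T := T) (G := L N + 1)
      ((Finset.range (R * (L N + 1))).filter fun i => E (N, m) i = true) fun s hs => by
        have hs0 : 0 ≤ s * (L N + 1) := mul_nonneg hs.1.1 (hLpos N).le
        have hi1 := Nat.floor_le hs0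
        have hi2 := Nat.lt_floor_add_one (s * (L N + 1))
        set i := ⌊s * (L N + 1)⌋₊ with hi
        have hcell : s ∈ Set.Icc ((i : ℝ) / (L N + 1)) ((i + 1) / (L N + 1)) :=
          ⟨(div_le_iff₀ (hLpos N)).2 hi1, (le_div_iff₀ (hLpos N)).2 hi2.le⟩
        refine ⟨i, Finset.mem_filter.2 ⟨Finset.mem_range.2 ?_, (hEs N m i).1 fun n hn => ?_⟩,
          hcell⟩
        · have : (i : ℝ) < R * (L N + 1) :=
            hi1.trans_lt (mul_lt_mul_of_pos_right hs.1.2 (hLpos N))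
          exact_mod_cast this
        · rw [signSum_congr _ fun j hj => hmα j (hj.trans_le hn)]
          refine (hclose α N i s _ hcell (hleft N i) n hn M (hs.2 n)).trans (le_of_eq ?_)
          push_cast; ring
    rw [← Nat.count_eq_card_filter_range] at hcover
    have h1 : ((Q : ENNReal))⁻¹ < ENNReal.ofReal (cells N m / (L N + 1)) := hQ.trans_le hcover
    have hQ0 : Q ≠ 0 := by
      rintro rfl
      rw [Nat.cast_zero, ENNReal.inv_zero] at h1
      exact absurd h1 (not_lt.2 le_top)
    have hQpos : (0 : ℝ) < Q := by exact_mod_cast Nat.pos_of_ne_zero hQ0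
    rw [← ENNReal.ofReal_natCast, ← ENNReal.ofReal_inv_of_pos hQpos,
      ENNReal.ofReal_lt_ofReal_iff_of_nonneg (by positivity), inv_lt_iff_one_lt_mul₀ hQpos,
      mul_comm _ (Q : ℝ), mul_div_assoc', lt_div_iff₀ (hLpos N), one_mul] at h1
    have h2 : L N + 1 < Q * cells N m := by exact_mod_cast h1
    exact decide_eq_true h2.le

theorem randomFourierPartialSum_eq_signSum (α : ℕ → Bool) (x φ : ℕ → ℝ) (N : ℕ) (t : ℝ) :
    randomFourierPartialSum α x φ N t = signSum α (trigTerm x φ (2 * Real.pi * t)) N := by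
  refine Finset.sum_congr rfl fun j _ => ?_
  rw [trigTerm, mul_assoc (rademacher α j)]
  congr 4
  ring

theorem mainTheorem7 (U : List Bool →. List Bool) (hU : IsOptimalPrefixMachine U)
    (x φ : ℕ → ℝ) (hx : IsComputableRealSeq x) (hφ : IsComputableRealSeq φ)
    (hsum : Tendsto (fun N : ℕ => ∑ n ∈ Finset.range N, x n ^ 2) atTop atTop)
    (α : ℕ → Bool) (hα : IsKC U α) :
    ∀ᵐ t ∂(volume.restrict (Set.Icc (0 : ℝ) 1)),
      ¬ ∃ s : ℝ, Tendsto (fun N : ℕ => randomFourierPartialSum α x φ N t) atTop (𝓝 s) := by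
  -- `2 π < 7`, so that `2 π t` lies in `[0, 7)` for `t` in `[0, 1]`
  have hae : ∀ᵐ s : ℝ, ∀ M : ℕ,
      ¬ (s ∈ Set.Ico (0 : ℝ) (7 : ℕ) ∧ ∀ n, |signSum α (trigTerm x φ s) n| ≤ M) :=
    ae_all_iff.2 fun M => measure_eq_zero_iff_ae_notMem.1
      (volume_bounded_partialSums_eq_zero hU hx hφ hsum hα M 7)
  have hscale := (Measure.quasiMeasurePreserving_smul (volume : Measure ℝ)
    (r := 2 * Real.pi) (by positivity)).ae hae
  filter_upwards [ae_restrict_of_ae hscale, ae_restrict_mem measurableSet_Icc] with t ht ht01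
  rintro ⟨s, hs⟩
  obtain ⟨C, hC⟩ := (Metric.isBounded_range_of_tendsto _ hs).exists_norm_le
  obtain ⟨M, hM⟩ := exists_nat_ge C
  refine ht M ⟨⟨?_, ?_⟩, fun n => ?_⟩
  · exact mul_nonneg (by positivity) ht01.1
  · have h1 : 2 * Real.pi * t ≤ 2 * Real.pi * 1 :=
      mul_le_mul_of_nonneg_left ht01.2 (by positivity)
    rw [smul_eq_mul]
    push_cast
    linarith [Real.pi_lt_d2]
  · rw [smul_eq_mul, ← randomFourierPartialSum_eq_signSum]
    exact (hC _ (Set.mem_range_self n)).trans hM
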